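/- A Blaschke product is a function on the unit disc $\mathbb{D}$ of the form $$B(z)=\prod_{n}\frac{\overline{z}_{n}}{|z_{n}|}\,\frac{z_{n}-z}{1-\overline{z}_{n}z},\qquad z\in\mathbb{D},$$ where $\{z_n\}$ is a finite (possibly empty) or infinite sequence of points of $\mathbb{D}$, repetitions allowed, with $\sum_n(1-|z_n|)<\infty$, and $\overline{z}_n/|z_n|$ is read as $1$ if $z_n=0$. It is called exponential if there is a constant $M=M(B)>0$ such that for every $k=1,2,\dots$ the number of zeros of $B$, counted with multiplicity, in the annulus $\{z: 2^{-k-1}\le 1-|z|\le 2^{-k}\}$ is at most $M$. The weak Hardy space $H^1_w$ consists of the analytic functions $f$ in $\mathbb{D}$ for which there is a constant $C=C(f)>0$ such that $$\bigl|\{e^{i\theta}: |f(re^{i\theta})|>\lambda\}\bigr|\le \frac{C}{\lambda}\qquad\text{for all } 0<r<1 \text{ and all } \lambda>0,$$ where $|E|$ denotes the length of a set $E\subset\partial\mathbb{D}$. **Theorem.** Let $B$ be a Blaschke product. Then $B'\in H^1_w$ if and only if $B$ is an exponential Blaschke product. -/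

import Mathlib

noncomputable section

/-- The Blaschke factor `(conj a / |a|) * (a - w) / (1 - conj a * w)` with zero `a`, with the
convention that `conj a / |a| = 1` when `a = 0`. -/
def blaschkeFactor (a w : ℂ) : ℂ :=
  (if a = 0 then 1 else (starRingEnd ℂ) a / (‖a‖ : ℂ)) *
    ((a - w) / (1 - (starRingEnd ℂ) a * w))

/-- `B` is, on the unit disc, the Blaschke product of a finite or countable family of points
`z i` of the disc (repetitions allowed) satisfying the Blaschke condition
`∑ (1 - |z i|) < ∞`. Nothing is required of `B` outside the disc. -/
def IsBlaschkeProduct (B : ℂ → ℂ) : Prop :=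
  ∃ (ι : Type) (_ : Countable ι) (z : ι → ℂ),
    (∀ i, ‖z i‖ < 1) ∧
    Summable (fun i => 1 - ‖z i‖) ∧
    ∀ w ∈ Metric.ball (0 : ℂ) 1, HasProd (fun i => blaschkeFactor (z i) w) (B w)

/-- The closed dyadic annulus `2^(-k-1) ≤ 1 - |a| ≤ 2^(-k)`. -/
def dyadicAnnulus (k : ℕ) : Set ℂ :=
  {a | (1 / 2 : ℝ) ^ (k + 1) ≤ 1 - ‖a‖ ∧ 1 - ‖a‖ ≤ (1 / 2 : ℝ) ^ k}

/-- The number of zeros of `B` in each annulus `2^(-k-1) ≤ 1 - |a| ≤ 2^(-k)`, `k = 1, 2, …`, is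
bounded by a constant independent of `k`. Zeros are counted with multiplicity: the count is at
most `M` when the orders of vanishing at any finitely many zeros in the annulus add up to at
most `M`. -/
def HasExponentialZeros (B : ℂ → ℂ) : Prop :=
  ∃ M : ℕ, 0 < M ∧ ∀ k : ℕ, 1 ≤ k → ∀ S : Finset ℂ,
    (∀ a ∈ S, B a = 0 ∧ a ∈ dyadicAnnulus k) → ∑ a ∈ S, analyticOrderAt B a ≤ (M : ℕ∞)

/-- An exponential Blaschke product. -/
def IsExponentialBlaschkeProduct (B : ℂ → ℂ) : Prop :=
  IsBlaschkeProduct B ∧ HasExponentialZeros B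

/-- Membership in the weak Hardy space `H^p_w` of the unit disc: `f` is analytic in the disc and
the length of `{e^{iθ} : |f (r e^{iθ})| > t}` is at most `C * t ^ (-p)`, with `C` independent of
`0 < r < 1` and `t > 0`. -/
def MemWeakHardy (f : ℂ → ℂ) (p : ℝ) : Prop :=
  DifferentiableOn ℂ f (Metric.ball (0 : ℂ) 1) ∧
  ∃ C : ℝ, 0 < C ∧ ∀ r : ℝ, 0 < r → r < 1 → ∀ t : ℝ, 0 < t →
    MeasureTheory.volume {θ : ℝ | θ ∈ Set.Ico 0 (2 * Real.pi) ∧ t < ‖f (circleMap 0 r θ)‖} ≤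
      ENNReal.ofReal (C * t ^ (-p))

end

open Filter Topology Metric ComplexConjugate MeasureTheory

/-! ### A single Blaschke factor -/

/-! Exponential implies weak type. The product rule bounds `|B'(w)|` by the sum of `(1 - |z i|²) /
|1 - conj (z i) w|²`. At height `t ~ 2^K`, zeros with `1 - |z i| > 2^(-K)` contribute at most a
multiple of the geometric sum of `2^k`, `k < K`, hence of `2^K`. Around the direction of each deeper
zero one discards an arc, with radii decaying geometrically from `2^(-K)`, slowly enough that off
the arcs the remaining terms still sum to a multiple of `2^K`. Since each level has at most `M`
zeros, the discarded length is `O(2^(-K)) = O(1/t)` (`IsBlaschkeProductOf.memWeakHardy_deriv`).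

Weak type implies exponential. Suppose `|B| ≤ 1 - c` at radius `r` over a set `E` of directions. The
mean of `1 - |B|` tends to zero at the boundary, so `c |E|` is at most the integral of `|B'|` over
`E × (r, 1)`. The weak bound, truncated by `|B'| ≤ 2 / (1 - s)`, controls this with only a
logarithmic loss, which is integrable in `s`, and yields `|E| ≤ K (1 - r)` (`volume_le_of_norm_le`).
On the other hand, `m` zeros of level `k` near one dyadic cell keep `|B|` away from 1 over that
whole cell at the radius with `1 - r = 2^(-k) / m` (`norm_le_of_card_le`). Hence `L` cells with at
least `m` zeros each satisfy `L m ≤ K`. Taking `m = 1`, then `L = 1`, bounds both the number of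
occupied cells and the number of zeros per cell, so a level has at most `K²` zeros. -/

theorem one_sub_conj_mul_ne_zero {a w : ℂ} (ha : ‖a‖ < 1) (hw : ‖w‖ < 1) :
    1 - conj a * w ≠ 0 := by
  intro h
  have h1 : ‖conj a * w‖ = 1 := by rw [← sub_eq_zero.1 h]; simp
  rw [norm_mul, RCLike.norm_conj] at h1
  nlinarith [norm_nonneg a, norm_nonneg w]

theorem one_sub_norm_le_norm_one_sub_conj_mul {a w : ℂ} (hw : ‖w‖ ≤ 1) :
    1 - ‖a‖ ≤ ‖1 - conj a * w‖ := by
  have h := norm_sub_norm_le (1 : ℂ) (conj a * w)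
  rw [norm_one, norm_mul, RCLike.norm_conj] at h
  nlinarith [norm_nonneg a, norm_nonneg w]

theorem norm_blaschkeFactor (a w : ℂ) :
    ‖blaschkeFactor a w‖ = ‖a - w‖ / ‖1 - conj a * w‖ := by
  unfold blaschkeFactor
  split_ifs with h
  · simp
  · have : ‖a‖ ≠ 0 := by simpa using h
    rw [norm_mul, norm_div, norm_div, RCLike.norm_conj, Complex.norm_real, norm_norm,
      div_self this, one_mul]

theorem normSq_one_sub_conj_mul_sub (a w : ℂ) :
    ‖1 - conj a * w‖ ^ 2 - ‖a - w‖ ^ 2 = (1 - ‖a‖ ^ 2) * (1 - ‖w‖ ^ 2) := by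
  simp only [Complex.sq_norm, Complex.normSq_apply]
  simp
  ring

theorem one_sub_normSq_blaschkeFactor {a w : ℂ} (ha : ‖a‖ < 1) (hw : ‖w‖ < 1) :
    1 - ‖blaschkeFactor a w‖ ^ 2
      = (1 - ‖a‖ ^ 2) * (1 - ‖w‖ ^ 2) / ‖1 - conj a * w‖ ^ 2 := by
  have h : ‖1 - conj a * w‖ ≠ 0 := norm_ne_zero_iff.2 (one_sub_conj_mul_ne_zero ha hw)
  rw [norm_blaschkeFactor, ← normSq_one_sub_conj_mul_sub, div_pow, sub_div,
    div_self (pow_ne_zero 2 h)]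

theorem norm_blaschkeFactor_le_one {a w : ℂ} (ha : ‖a‖ < 1) (hw : ‖w‖ < 1) :
    ‖blaschkeFactor a w‖ ≤ 1 := by
  have h := one_sub_normSq_blaschkeFactor ha hw
  have h2 : 0 ≤ (1 - ‖a‖ ^ 2) * (1 - ‖w‖ ^ 2) / ‖1 - conj a * w‖ ^ 2 := by
    have : 0 ≤ 1 - ‖a‖ ^ 2 := by nlinarith [norm_nonneg a]
    have : 0 ≤ 1 - ‖w‖ ^ 2 := by nlinarith [norm_nonneg w]
    positivity
  nlinarith [norm_nonneg (blaschkeFactor a w)]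

theorem blaschkeFactor_eq_zero_iff {a w : ℂ} (ha : ‖a‖ < 1) (hw : ‖w‖ < 1) :
    blaschkeFactor a w = 0 ↔ w = a := by
  have h : ‖1 - conj a * w‖ ≠ 0 := norm_ne_zero_iff.2 (one_sub_conj_mul_ne_zero ha hw)
  rw [← norm_eq_zero, norm_blaschkeFactor, div_eq_zero_iff, or_iff_left h, norm_eq_zero,
    sub_eq_zero, eq_comm]

theorem norm_blaschkeFactor_zero (a : ℂ) : ‖blaschkeFactor a 0‖ = ‖a‖ := by
  simp [norm_blaschkeFactor]

/-- The normalization `conj a / |a|` is what brings the factor close to 1 as `|a| → 1`. This is the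
majorant that turns the Blaschke condition into locally uniform convergence. -/
theorem norm_blaschkeFactor_sub_one_le {a w : ℂ} {ρ : ℝ} (ha : ‖a‖ < 1) (hw : ‖w‖ < ρ)
    (hρ : ρ < 1) : ‖blaschkeFactor a w - 1‖ ≤ (1 - ‖a‖) * (2 / (1 - ρ)) := by
  have hw1 : ‖w‖ < 1 := hw.trans hρ
  have hne := one_sub_conj_mul_ne_zero ha hw1
  have hden : 1 - ρ ≤ ‖1 - conj a * w‖ := by
    have h := norm_sub_norm_le (1 : ℂ) (conj a * w)
    rw [norm_one, norm_mul, RCLike.norm_conj] at h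
    nlinarith [norm_nonneg a, norm_nonneg w]
  have hρ' : 0 < 1 - ρ := by linarith
  unfold blaschkeFactor
  split_ifs with h
  · subst h
    have h1 : ‖(1 : ℂ) * ((0 - w) / (1 - conj (0 : ℂ) * w)) - 1‖ ≤ 2 := by
      calc _ = ‖-w - 1‖ := by simp
        _ ≤ ‖-w‖ + ‖(1 : ℂ)‖ := norm_sub_le _ _
        _ ≤ 2 := by rw [norm_neg, norm_one]; linarith
    refine h1.trans ?_
    rw [norm_zero, sub_zero, one_mul, le_div_iff₀ hρ']
    nlinarith [norm_nonneg w]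
  · have hn : (‖a‖ : ℂ) ≠ 0 := by simpa using h
    have hn' : 0 < ‖a‖ := norm_pos_iff.2 h
    have hsq : conj a * a = (‖a‖ : ℂ) ^ 2 := by
      rw [mul_comm, Complex.mul_conj, Complex.normSq_eq_norm_sq]; push_cast; ring
    have key : conj a / (‖a‖ : ℂ) * ((a - w) / (1 - conj a * w)) - 1
        = ((‖a‖ - 1 : ℝ) : ℂ) * (‖a‖ + conj a * w) / (‖a‖ * (1 - conj a * w)) := by
      rw [div_mul_div_comm, div_sub_one (mul_ne_zero hn hne), mul_sub, hsq]
      push_cast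
      ring
    rw [key, norm_div, norm_mul, norm_mul, Complex.norm_real, Complex.norm_real, norm_norm,
      Real.norm_eq_abs, abs_of_nonpos (by linarith), neg_sub]
    -- The factor `‖a‖` cancels the one in the denominator, so the bound does not degenerate as `a →
    -- 0`.
    have hnum : ‖(‖a‖ : ℂ) + conj a * w‖ ≤ ‖a‖ * 2 := by
      refine (norm_add_le _ _).trans ?_
      rw [Complex.norm_real, norm_norm, norm_mul, RCLike.norm_conj]
      nlinarith
    have h1 : 0 ≤ 1 - ‖a‖ := by linarith
    calc (1 - ‖a‖) * ‖(‖a‖ : ℂ) + conj a * w‖ / (‖a‖ * ‖1 - conj a * w‖)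
        ≤ (1 - ‖a‖) * (‖a‖ * 2) / (‖a‖ * (1 - ρ)) := by gcongr
      _ = (1 - ‖a‖) * (2 / (1 - ρ)) := by field_simp

theorem hasDerivAt_blaschkeFactor {a w : ℂ} (ha : ‖a‖ < 1) (hw : ‖w‖ < 1) :
    HasDerivAt (blaschkeFactor a)
      ((if a = 0 then 1 else conj a / (‖a‖ : ℂ)) *
        (-(1 - conj a * a) / (1 - conj a * w) ^ 2)) w := by
  have h1 : HasDerivAt (fun w : ℂ => a - w) (-1) w := by
    simpa using (hasDerivAt_id w).const_sub a
  have h2 : HasDerivAt (fun w : ℂ => 1 - conj a * w) (-conj a) w := by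
    simpa using ((hasDerivAt_id w).const_mul (conj a)).const_sub 1
  refine ((h1.div h2 (one_sub_conj_mul_ne_zero ha hw)).const_mul
    (if a = 0 then 1 else conj a / (‖a‖ : ℂ))).congr_deriv ?_
  congr 2
  ring

theorem norm_deriv_blaschkeFactor {a w : ℂ} (ha : ‖a‖ < 1) (hw : ‖w‖ < 1) :
    ‖deriv (blaschkeFactor a) w‖ = (1 - ‖a‖ ^ 2) / ‖1 - conj a * w‖ ^ 2 := by
  rw [(hasDerivAt_blaschkeFactor ha hw).deriv, norm_mul, norm_div, norm_pow, norm_neg]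
  have h1 : ‖(if a = 0 then 1 else conj a / (‖a‖ : ℂ))‖ = 1 := by
    split_ifs with h
    · simp
    · have : ‖a‖ ≠ 0 := by simpa using h
      rw [norm_div, RCLike.norm_conj, Complex.norm_real, norm_norm, div_self this]
  have h2 : ‖1 - conj a * a‖ = 1 - ‖a‖ ^ 2 := by
    rw [mul_comm, Complex.mul_conj, Complex.normSq_eq_norm_sq, ← Complex.ofReal_one,
      ← Complex.ofReal_sub, Complex.norm_real, Real.norm_eq_abs, abs_of_nonneg]
    nlinarith [norm_nonneg a]
  rw [h1, h2, one_mul]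

theorem differentiableOn_blaschkeFactor {a : ℂ} (ha : ‖a‖ < 1) :
    DifferentiableOn ℂ (blaschkeFactor a) (ball 0 1) := fun _ hw =>
  (hasDerivAt_blaschkeFactor ha (mem_ball_zero_iff.1 hw)).differentiableAt.differentiableWithinAt

theorem analyticOrderAt_blaschkeFactor_self {a : ℂ} (ha : ‖a‖ < 1) :
    analyticOrderAt (blaschkeFactor a) a = 1 := by
  refine AnalyticAt.analyticOrderAt_eq_one_of_zero_deriv_ne_zero
    ((differentiableOn_blaschkeFactor ha).analyticAt
      (isOpen_ball.mem_nhds (mem_ball_zero_iff.2 ha)))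
    ((blaschkeFactor_eq_zero_iff ha ha).2 rfl) ?_
  rw [← norm_ne_zero_iff, norm_deriv_blaschkeFactor ha ha]
  have h1 : 1 - ‖a‖ ^ 2 ≠ 0 := by nlinarith [norm_nonneg a]
  exact div_ne_zero h1 (pow_ne_zero _ (norm_ne_zero_iff.2 (one_sub_conj_mul_ne_zero ha ha)))

/-! ### Blaschke products with a given family of zeros -/

/-- `B` is on the unit disc the Blaschke product with zeros `z i`. -/
structure IsBlaschkeProductOf {ι : Type*} (z : ι → ℂ) (B : ℂ → ℂ) : Prop where
  norm_lt : ∀ i, ‖z i‖ < 1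
  summable : Summable fun i => 1 - ‖z i‖
  hasProd : ∀ w ∈ ball (0 : ℂ) 1, HasProd (fun i => blaschkeFactor (z i) w) (B w)

namespace IsBlaschkeProductOf

variable {ι : Type*} {z : ι → ℂ} {B : ℂ → ℂ}

theorem norm_le_norm_prod (h : IsBlaschkeProductOf z B) {w : ℂ} (hw : ‖w‖ < 1) (F : Finset ι) :
    ‖B w‖ ≤ ∏ i ∈ F, ‖blaschkeFactor (z i) w‖ := by
  refine le_of_tendsto (h.hasProd w (mem_ball_zero_iff.2 hw)).norm ?_
  filter_upwards [eventually_ge_atTop F] with G hG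
  exact Finset.prod_le_prod_of_subset_of_le_one hG (fun _ _ => norm_nonneg _)
    fun i _ _ => norm_blaschkeFactor_le_one (h.norm_lt i) hw

theorem norm_le_one (h : IsBlaschkeProductOf z B) {w : ℂ} (hw : ‖w‖ < 1) : ‖B w‖ ≤ 1 := by
  simpa using h.norm_le_norm_prod hw ∅

theorem summable_norm_sub_one (h : IsBlaschkeProductOf z B) {w : ℂ} (hw : ‖w‖ < 1) :
    Summable fun i => ‖blaschkeFactor (z i) w - 1‖ := by
  obtain ⟨ρ, h1, h2⟩ := exists_between hw
  exact (h.summable.mul_right (2 / (1 - ρ))).of_nonneg_of_le (fun _ => norm_nonneg _)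
    fun i => norm_blaschkeFactor_sub_one_le (h.norm_lt i) h1 h2

theorem tendstoLocallyUniformlyOn (h : IsBlaschkeProductOf z B) {ρ : ℝ} (hρ : ρ < 1) :
    TendstoLocallyUniformlyOn (fun (F : Finset ι) w => ∏ i ∈ F, blaschkeFactor (z i) w) B atTop
      (ball 0 ρ) := by
  have hsub : ball (0 : ℂ) ρ ⊆ ball 0 1 := ball_subset_ball hρ.le
  have h1 := Summable.hasProdLocallyUniformlyOn_one_add (f := fun i w => blaschkeFactor (z i) w - 1)
    (isOpen_ball (x := (0 : ℂ)) (ε := ρ)) (h.summable.mul_right (2 / (1 - ρ)))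
    (Eventually.of_forall fun i w hw =>
      norm_blaschkeFactor_sub_one_le (h.norm_lt i) (mem_ball_zero_iff.1 hw) hρ)
    (fun i => (((differentiableOn_blaschkeFactor (h.norm_lt i)).mono hsub).continuousOn).sub
      continuousOn_const)
  simp only [add_sub_cancel] at h1
  rw [hasProdLocallyUniformlyOn_iff_tendstoLocallyUniformlyOn] at h1
  have h2 := h1.congr_right (g := B) fun w hw => (h.hasProd w (hsub hw)).tprod_eq
  exact h2.congr fun F w _ => by simp

theorem differentiableOn_prod (h : IsBlaschkeProductOf z B) (F : Finset ι) :
    DifferentiableOn ℂ (fun w => ∏ i ∈ F, blaschkeFactor (z i) w) (ball 0 1) :=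
  DifferentiableOn.fun_finsetProd fun i _ => differentiableOn_blaschkeFactor (h.norm_lt i)

theorem differentiableOn (h : IsBlaschkeProductOf z B) : DifferentiableOn ℂ B (ball 0 1) := by
  intro w hw
  obtain ⟨ρ, h1, h2⟩ := exists_between (mem_ball_zero_iff.1 hw)
  have h3 := (h.tendstoLocallyUniformlyOn h2).differentiableOn
    (Eventually.of_forall fun F => (h.differentiableOn_prod F).mono (ball_subset_ball h2.le))
    isOpen_ball
  exact (h3.differentiableAt
    (isOpen_ball.mem_nhds (mem_ball_zero_iff.2 h1))).differentiableWithinAt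

theorem analyticAt (h : IsBlaschkeProductOf z B) {w : ℂ} (hw : ‖w‖ < 1) : AnalyticAt ℂ B w :=
  h.differentiableOn.analyticAt (isOpen_ball.mem_nhds (mem_ball_zero_iff.2 hw))

theorem norm_deriv_prod_le (h : IsBlaschkeProductOf z B) (F : Finset ι) {w : ℂ} (hw : ‖w‖ < 1) :
    ‖deriv (fun w => ∏ i ∈ F, blaschkeFactor (z i) w) w‖
      ≤ ∑ i ∈ F, (1 - ‖z i‖ ^ 2) / ‖1 - conj (z i) * w‖ ^ 2 := by
  classical
  have h1 : HasDerivAt (fun w => ∏ i ∈ F, blaschkeFactor (z i) w)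
      (∑ i ∈ F, (∏ j ∈ F.erase i, blaschkeFactor (z j) w) • deriv (blaschkeFactor (z i)) w) w :=
    HasDerivAt.fun_finsetProd fun i _ =>
      (hasDerivAt_blaschkeFactor (h.norm_lt i) hw).differentiableAt.hasDerivAt
  rw [h1.deriv]
  refine (norm_sum_le _ _).trans (Finset.sum_le_sum fun i _ => ?_)
  rw [norm_smul, norm_deriv_blaschkeFactor (h.norm_lt i) hw, norm_prod]
  refine mul_le_of_le_one_left ?_ (Finset.prod_le_one (fun _ _ => norm_nonneg _)
    fun j _ => norm_blaschkeFactor_le_one (h.norm_lt j) hw)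
  rw [← norm_deriv_blaschkeFactor (h.norm_lt i) hw]
  exact norm_nonneg _

theorem norm_deriv_le_of_sum_le (h : IsBlaschkeProductOf z B) {w : ℂ} (hw : ‖w‖ < 1) {K : ℝ}
    (hK : ∀ F : Finset ι, ∑ i ∈ F, (1 - ‖z i‖ ^ 2) / ‖1 - conj (z i) * w‖ ^ 2 ≤ K) :
    ‖deriv B w‖ ≤ K := by
  obtain ⟨ρ, h1, h2⟩ := exists_between hw
  have h3 := (h.tendstoLocallyUniformlyOn h2).deriv
    (Eventually.of_forall fun F => (h.differentiableOn_prod F).mono (ball_subset_ball h2.le))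
    isOpen_ball
  refine le_of_tendsto (h3.tendsto_at (mem_ball_zero_iff.2 h1)).norm
    (Eventually.of_forall fun F => (h.norm_deriv_prod_le F hw).trans (hK F))

/-- Cauchy-type estimate on the disc of radius `1 - ‖w‖` about `w`, where `B` stays within distance
2 of `B w`. -/
theorem norm_deriv_le (h : IsBlaschkeProductOf z B) {w : ℂ} (hw : ‖w‖ < 1) :
    ‖deriv B w‖ ≤ 2 / (1 - ‖w‖) := by
  have hsub : ∀ v ∈ ball w (1 - ‖w‖), ‖v‖ < 1 := fun v hv => by
    have h1 := norm_sub_norm_le v w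
    rw [mem_ball_iff_norm] at hv
    linarith
  refine Complex.norm_deriv_le_div_of_mapsTo_ball
    (h.differentiableOn.mono fun v hv => mem_ball_zero_iff.2 (hsub v hv)) (fun v hv => ?_)
    (by linarith)
  rw [mem_closedBall_iff_norm]
  refine (norm_sub_le _ _).trans ?_
  linarith [h.norm_le_one (hsub v hv), h.norm_le_one hw]

/-- Splitting off finitely many factors. -/
theorem exists_eq_prod_mul (h : IsBlaschkeProductOf z B) (F : Finset ι) :
    ∃ R : ℂ → ℂ, IsBlaschkeProductOf (fun i : {i // i ∉ F} => z i) R ∧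
      ∀ w ∈ ball (0 : ℂ) 1, B w = (∏ i ∈ F, blaschkeFactor (z i) w) * R w := by
  have hm : ∀ w ∈ ball (0 : ℂ) 1,
      Multipliable fun i : {i // i ∉ F} => blaschkeFactor (z i) w := fun w hw => by
    have := multipliable_one_add_of_summable (ι := {i // i ∉ F})
      (f := fun i => blaschkeFactor (z i) w - 1)
      ((h.summable_norm_sub_one (mem_ball_zero_iff.1 hw)).subtype {i | i ∉ F})
    simpa using this
  refine ⟨fun w => ∏' i : {i // i ∉ F}, blaschkeFactor (z i) w,
    ⟨fun i => h.norm_lt i, h.summable.subtype {i | i ∉ F}, fun w hw => (hm w hw).hasProd⟩,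
    fun w hw => ?_⟩
  have h1 : HasProd (fun i : {i // i ∈ F} => blaschkeFactor (z i) w)
      (∏ i ∈ F, blaschkeFactor (z i) w) := by
    rw [← Finset.prod_coe_sort]
    exact hasProd_fintype _
  exact (h.hasProd w hw).unique (h1.mul_compl (s := {i | i ∈ F}) (hm w hw).hasProd)

theorem ne_zero_of_forall_ne (h : IsBlaschkeProductOf z B) {w : ℂ} (hw : ‖w‖ < 1)
    (hne : ∀ i, z i ≠ w) : B w ≠ 0 := by
  rw [← (h.hasProd w (mem_ball_zero_iff.2 hw)).tprod_eq]
  have := tprod_one_add_ne_zero_of_summable (f := fun i => blaschkeFactor (z i) w - 1)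
    (fun i => by
      rw [add_sub_cancel, Ne, blaschkeFactor_eq_zero_iff (h.norm_lt i) hw]
      exact (hne i).symm) (h.summable_norm_sub_one hw)
  simpa using this

theorem finite_setOf_le (h : IsBlaschkeProductOf z B) {ε : ℝ} (hε : 0 < ε) :
    {i | ε ≤ 1 - ‖z i‖}.Finite := by
  have := h.summable.tendsto_cofinite_zero.eventually (gt_mem_nhds hε)
  simpa [Filter.eventually_cofinite] using this

theorem analyticOrderAt_prod_of_forall_eq {a : ℂ} (ha : ‖a‖ < 1) {G : Finset ι}
    (hG : ∀ i ∈ G, z i = a) :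
    AnalyticAt ℂ (fun w => ∏ i ∈ G, blaschkeFactor (z i) w) a ∧
      analyticOrderAt (fun w => ∏ i ∈ G, blaschkeFactor (z i) w) a = G.card := by
  have han : AnalyticAt ℂ (blaschkeFactor a) a :=
    (differentiableOn_blaschkeFactor ha).analyticAt
      (isOpen_ball.mem_nhds (mem_ball_zero_iff.2 ha))
  have he : (fun w => ∏ i ∈ G, blaschkeFactor (z i) w) = blaschkeFactor a ^ G.card := by
    funext w
    rw [Finset.prod_congr rfl fun i hi => by rw [hG i hi], Finset.prod_const, Pi.pow_apply]
  rw [he]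
  refine ⟨han.pow _, ?_⟩
  rw [analyticOrderAt_pow han, analyticOrderAt_blaschkeFactor_self ha]
  simp

theorem card_le_analyticOrderAt (h : IsBlaschkeProductOf z B) {a : ℂ} (ha : ‖a‖ < 1)
    {G : Finset ι} (hG : ∀ i ∈ G, z i = a) : (G.card : ℕ∞) ≤ analyticOrderAt B a := by
  obtain ⟨R, hR, hBR⟩ := h.exists_eq_prod_mul G
  obtain ⟨h1, h2⟩ := analyticOrderAt_prod_of_forall_eq ha hG
  have : B =ᶠ[𝓝 a] (fun w => ∏ i ∈ G, blaschkeFactor (z i) w) * R := by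
    filter_upwards [isOpen_ball.mem_nhds (mem_ball_zero_iff.2 ha)] with w hw using hBR w hw
  rw [analyticOrderAt_congr this, analyticOrderAt_mul h1 (hR.analyticAt ha), h2]
  exact le_self_add

/-- The indices with `z i = a` are finitely many by the Blaschke condition. Once their factors are
split off, the remaining product does not vanish at `a`. -/
theorem exists_card_eq_analyticOrderAt (h : IsBlaschkeProductOf z B) {a : ℂ} (ha : ‖a‖ < 1) :
    ∃ G : Finset ι, (∀ i ∈ G, z i = a) ∧ (G.card : ℕ∞) = analyticOrderAt B a := by
  have hfin : {i | z i = a}.Finite :=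
    (h.finite_setOf_le (sub_pos.2 ha)).subset fun i (hi : z i = a) => by simp [hi]
  have hG : ∀ i ∈ hfin.toFinset, z i = a := fun i hi => by simpa using hi
  refine ⟨hfin.toFinset, hG, ?_⟩
  obtain ⟨R, hR, hBR⟩ := h.exists_eq_prod_mul hfin.toFinset
  obtain ⟨h1, h2⟩ := analyticOrderAt_prod_of_forall_eq ha hG
  have : B =ᶠ[𝓝 a] (fun w => ∏ i ∈ hfin.toFinset, blaschkeFactor (z i) w) * R := by
    filter_upwards [isOpen_ball.mem_nhds (mem_ball_zero_iff.2 ha)] with w hw using hBR w hw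
  rw [analyticOrderAt_congr this, analyticOrderAt_mul h1 (hR.analyticAt ha), h2,
    (hR.analyticAt ha).analyticOrderAt_eq_zero.2, add_zero]
  exact hR.ne_zero_of_forall_ne ha fun i hi => i.2 (by simpa using hi)

end IsBlaschkeProductOf

theorem isBlaschkeProduct_iff {B : ℂ → ℂ} :
    IsBlaschkeProduct B ↔
      ∃ (ι : Type) (_ : Countable ι) (z : ι → ℂ), IsBlaschkeProductOf z B :=
  ⟨fun ⟨ι, hι, z, h1, h2, h3⟩ => ⟨ι, hι, z, h1, h2, h3⟩,
    fun ⟨ι, hι, z, h⟩ => ⟨ι, hι, z, h.norm_lt, h.summable, h.hasProd⟩⟩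

/-! ### Counting zeros by level -/

namespace IsBlaschkeProductOf

variable {ι : Type*} {z : ι → ℂ} {B : ℂ → ℂ}

theorem norm_lt_one_of_mem_dyadicAnnulus {k : ℕ} {a : ℂ} (ha : a ∈ dyadicAnnulus k) :
    ‖a‖ < 1 := by
  have : (0 : ℝ) < (1 / 2) ^ (k + 1) := by positivity
  linarith [ha.1]

/-- Passes from orders of vanishing to counting indices, the form used in both directions. -/
theorem hasExponentialZeros_iff (h : IsBlaschkeProductOf z B) :
    HasExponentialZeros B ↔ ∃ M : ℕ, ∀ k : ℕ, 1 ≤ k → ∀ F : Finset ι,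
      (∀ i ∈ F, z i ∈ dyadicAnnulus k) → F.card ≤ M := by
  classical
  constructor
  · rintro ⟨M, -, hM⟩
    refine ⟨M, fun k hk F hF => ?_⟩
    have h1 := hM k hk (F.image z) fun a ha => by
      obtain ⟨i, hi, rfl⟩ := Finset.mem_image.1 ha
      have hi1 := h.norm_lt i
      refine ⟨?_, hF i hi⟩
      have h2 := h.norm_le_norm_prod hi1 {i}
      rw [Finset.prod_singleton, (blaschkeFactor_eq_zero_iff hi1 hi1).2 rfl, norm_zero] at h2
      exact norm_le_zero_iff.1 h2
    rw [Finset.card_eq_sum_card_image z F]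
    have h2 : ((∑ a ∈ F.image z, (F.filter (z · = a)).card : ℕ) : ℕ∞) ≤ M := by
      refine le_trans ?_ h1
      push_cast
      refine Finset.sum_le_sum fun a ha => ?_
      obtain ⟨i, hi, rfl⟩ := Finset.mem_image.1 ha
      exact h.card_le_analyticOrderAt (h.norm_lt i) fun j hj => (Finset.mem_filter.1 hj).2
    exact_mod_cast h2
  · rintro ⟨M, hM⟩
    -- `M + 1` only because the definition asks for a positive bound.
    refine ⟨M + 1, M.succ_pos, fun k hk S hS => ?_⟩
    have h1 : ∀ a, ∃ G : Finset ι, a ∈ S →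
        (∀ i ∈ G, z i = a) ∧ (G.card : ℕ∞) = analyticOrderAt B a := fun a => by
      by_cases ha : a ∈ S
      · obtain ⟨G, hG⟩ :=
          h.exists_card_eq_analyticOrderAt (norm_lt_one_of_mem_dyadicAnnulus (hS a ha).2)
        exact ⟨G, fun _ => hG⟩
      · exact ⟨∅, fun h => absurd h ha⟩
    choose G hG using h1
    have h2 : (S.biUnion G).card = ∑ a ∈ S, (G a).card := by
      refine Finset.card_biUnion fun a ha b hb hab => Finset.disjoint_left.2 fun i hi hj => ?_
      exact hab (((hG a ha).1 i hi).symm.trans ((hG b hb).1 i hj))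
    have h3 := hM k hk (S.biUnion G) fun i hi => by
      obtain ⟨a, ha, hi⟩ := Finset.mem_biUnion.1 hi
      rw [(hG a ha).1 i hi]
      exact (hS a ha).2
    rw [h2] at h3
    calc ∑ a ∈ S, analyticOrderAt B a = ((∑ a ∈ S, (G a).card : ℕ) : ℕ∞) := by
          push_cast
          exact Finset.sum_congr rfl fun a ha => (hG a ha).2.symm
      _ ≤ ((M + 1 : ℕ) : ℕ∞) := by exact_mod_cast h3.trans M.le_succ

/-- Adds the level `k = 0`, which the definition omits: only finitely many zeros have `1 - ‖z i‖ ≥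
1/2`. -/
theorem exists_card_le_of_hasExponentialZeros (h : IsBlaschkeProductOf z B)
    (hB : HasExponentialZeros B) : ∃ M : ℕ, 0 < M ∧ ∀ k : ℕ, ∀ F : Finset ι,
      (∀ i ∈ F, z i ∈ dyadicAnnulus k) → F.card ≤ M := by
  obtain ⟨M, hM⟩ := h.hasExponentialZeros_iff.1 hB
  have hfin := h.finite_setOf_le (ε := 1 / 2) (by norm_num)
  refine ⟨M + hfin.toFinset.card + 1, by omega, fun k F hF => ?_⟩
  rcases Nat.eq_zero_or_pos k with rfl | hk
  · have : F ⊆ hfin.toFinset := fun i hi => by simpa using (hF i hi).1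
    have := Finset.card_le_card this
    omega
  · have := hM k hk F hF
    omega

end IsBlaschkeProductOf

/-- Grouping the indices by level, each level `k` contributes at most `M * g k`. -/
theorem sum_comp_le_of_card_le {ι : Type*} {κ : ι → ℕ} {M : ℕ}
    (hM : ∀ k, ∀ F : Finset ι, (∀ i ∈ F, κ i = k) → F.card ≤ M) {g : ℕ → ℝ} (hg : ∀ k, 0 ≤ g k)
    {T : ℝ} (hT : ∀ n, ∑ k ∈ Finset.range n, g k ≤ T) (F : Finset ι) :
    ∑ i ∈ F, g (κ i) ≤ M * T := by
  classical
  have hmap : ∀ i ∈ F, κ i ∈ Finset.range (F.sup κ + 1) := fun i hi =>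
    Finset.mem_range.2 (Nat.lt_succ_of_le (Finset.le_sup hi))
  rw [← Finset.sum_fiberwise_of_maps_to hmap]
  calc _ ≤ ∑ k ∈ Finset.range (F.sup κ + 1), M * g k := by
        refine Finset.sum_le_sum fun k _ => ?_
        rw [Finset.sum_congr rfl (g := fun _ => g k)
          fun i hi => by rw [(Finset.mem_filter.1 hi).2], Finset.sum_const, nsmul_eq_mul]
        exact mul_le_mul_of_nonneg_right
          (by exact_mod_cast hM k _ fun i hi => (Finset.mem_filter.1 hi).2) (hg k)
    _ ≤ M * T := by
        rw [← Finset.mul_sum]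
        exact mul_le_mul_of_nonneg_left (hT _) (Nat.cast_nonneg _)

theorem sum_range_le_sum_add_sum {g : ℕ → ℝ} (hg : ∀ k, 0 ≤ g k) (K n : ℕ) :
    ∑ k ∈ Finset.range n, g k
      ≤ ∑ k ∈ Finset.range K, g k + ∑ j ∈ Finset.range n, g (K + j) := by
  rw [← Finset.sum_range_add]
  exact Finset.sum_le_sum_of_subset_of_nonneg (Finset.range_mono (Nat.le_add_left n K))
    fun i _ _ => hg i

theorem sum_range_pow_le {q : ℝ} (h0 : 0 ≤ q) (h1 : q < 1) (n : ℕ) :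
    ∑ j ∈ Finset.range n, q ^ j ≤ (1 - q)⁻¹ := by
  rw [← tsum_geometric_of_lt_one h0 h1]
  exact (summable_geometric_of_lt_one h0 h1).sum_le_tsum _ fun _ _ => pow_nonneg h0 _

/-! ### Arcs on the circle -/

theorem norm_exp_sub_exp (x y : ℝ) :
    ‖Complex.exp (x * Complex.I) - Complex.exp (y * Complex.I)‖ = 2 * |Real.sin ((x - y) / 2)| := by
  have h : Complex.exp (x * Complex.I) - Complex.exp (y * Complex.I)
      = Complex.exp (y * Complex.I) * (Complex.exp (Complex.I * ((x - y : ℝ) : ℂ)) - 1) := by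
    rw [mul_sub, mul_one, ← Complex.exp_add]
    congr 2
    push_cast
    ring
  rw [h, norm_mul, Complex.norm_exp_ofReal_mul_I, one_mul, Complex.norm_exp_I_mul_ofReal_sub_one,
    norm_mul, Real.norm_eq_abs, Real.norm_eq_abs, abs_two]

theorem abs_div_pi_le_abs_sin_half {x : ℝ} (hx : |x| ≤ Real.pi) :
    |x| / Real.pi ≤ |Real.sin (x / 2)| := by
  have h1 : 2 / Real.pi * (|x| / 2) ≤ Real.sin (|x| / 2) :=
    Real.mul_le_sin (by positivity) (by linarith)
  have h2 : |Real.sin (x / 2)| = Real.sin (|x| / 2) := by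
    have h3 : 0 ≤ Real.sin (|x| / 2) :=
      Real.sin_nonneg_of_nonneg_of_le_pi (by positivity) (by linarith [abs_nonneg x])
    rcases abs_cases x with ⟨h, _⟩ | ⟨h, _⟩
    · rw [h] at h3 ⊢
      exact abs_of_nonneg h3
    · rw [h] at h3 ⊢
      rw [neg_div, Real.sin_neg] at h3 ⊢
      exact abs_of_nonpos (by linarith)
  rw [h2]
  calc |x| / Real.pi = 2 / Real.pi * (|x| / 2) := by ring
    _ ≤ _ := h1

theorem volume_arc_le {y : ℝ} (hy : y ∈ Set.Ioc (-Real.pi) Real.pi) {s : ℝ} (hs : 0 ≤ s) :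
    MeasureTheory.volume {x : ℝ | x ∈ Set.Ico 0 (2 * Real.pi) ∧
      ‖Complex.exp (x * Complex.I) - Complex.exp (y * Complex.I)‖ < s}
      ≤ ENNReal.ofReal (8 * s) := by
  have hpi := Real.pi_pos
  have h4 := Real.pi_le_four
  have key : ∀ u : ℝ, |u| ≤ Real.pi → 2 * |Real.sin (u / 2)| < s → |u| < 2 * s := fun u hu hus => by
    have := abs_div_pi_le_abs_sin_half hu
    rw [div_le_iff₀ hpi] at this
    nlinarith [abs_nonneg (Real.sin (u / 2))]
  -- The arc may wrap around: `x` ranges over `[0, 2π)` but `y` over `(-π, π]`, so the translate by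
  -- `2π` is needed too. Two intervals of length `4 s` give `8 s`.
  have hsub : {x : ℝ | x ∈ Set.Ico 0 (2 * Real.pi) ∧
      ‖Complex.exp (x * Complex.I) - Complex.exp (y * Complex.I)‖ < s}
      ⊆ ball y (2 * s) ∪ ball (y + 2 * Real.pi) (2 * s) := by
    rintro x ⟨⟨hx0, hx1⟩, hx⟩
    rw [norm_exp_sub_exp] at hx
    rw [Set.mem_union, mem_ball, mem_ball, Real.dist_eq, Real.dist_eq]
    by_cases h : x - y ≤ Real.pi
    · exact Or.inl (key _ (abs_le.2 ⟨by linarith [hy.2], h⟩) hx)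
    · refine Or.inr (key _ (abs_le.2 ⟨by linarith [hy.1], by linarith [hy.1]⟩) ?_)
      rwa [show (x - (y + 2 * Real.pi)) / 2 = (x - y) / 2 - Real.pi by ring, Real.sin_sub_pi,
        abs_neg]
  refine (MeasureTheory.measure_mono hsub).trans ((MeasureTheory.measure_union_le _ _).trans ?_)
  rw [Real.volume_ball, Real.volume_ball, ← ENNReal.ofReal_add (by positivity) (by positivity)]
  exact ENNReal.ofReal_le_ofReal (by linarith)

theorem norm_one_sub_conj_mul_circleMap (a : ℂ) (r x : ℝ) :
    ‖1 - conj a * circleMap 0 r x‖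
      = ‖Complex.exp (a.arg * Complex.I) - ((‖a‖ * r : ℝ) : ℂ) * Complex.exp (x * Complex.I)‖ := by
  set e := Complex.exp (x * Complex.I)
  set f := Complex.exp (a.arg * Complex.I)
  have hf : ‖f‖ = 1 := Complex.norm_exp_ofReal_mul_I _
  have hff : f * conj f = 1 := by rw [Complex.mul_conj, Complex.normSq_eq_norm_sq, hf]; simp
  have ha' : conj a = ‖a‖ * conj f := by
    conv_lhs => rw [← Complex.norm_mul_exp_arg_mul_I a]
    rw [map_mul, Complex.conj_ofReal]
  have hz : circleMap 0 r x = r * e := by simp [circleMap, e]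
  have h1 : f * (1 - conj a * circleMap 0 r x) = f - ((‖a‖ * r : ℝ) : ℂ) * e := by
    rw [ha', hz]
    push_cast
    linear_combination (-(‖a‖ : ℂ) * r * e) * hff
  rw [← h1, norm_mul, hf, one_mul]

theorem norm_ofReal_mul_exp_sub_exp {ρ : ℝ} (hρ : ρ ≤ 1) (x : ℝ) :
    ‖(ρ : ℂ) * Complex.exp (x * Complex.I) - Complex.exp (x * Complex.I)‖ = 1 - ρ := by
  rw [← sub_one_mul, norm_mul, Complex.norm_exp_ofReal_mul_I, mul_one, ← Complex.ofReal_one,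
    ← Complex.ofReal_sub, Complex.norm_real, Real.norm_eq_abs, abs_of_nonpos (by linarith),
    neg_sub]

/-- With `ρ = ‖a‖ r`, moving from `ρ e^{ix}` to `e^{ix}` costs `1 - ρ`, itself at most the distance
from `ρ e^{ix}` to the unit circle; hence the factor 2. -/
theorem norm_exp_sub_exp_arg_le (a : ℂ) (ha : ‖a‖ ≤ 1) {r : ℝ} (hr0 : 0 ≤ r) (hr1 : r ≤ 1)
    (x : ℝ) : ‖Complex.exp (x * Complex.I) - Complex.exp (a.arg * Complex.I)‖
      ≤ 2 * ‖1 - conj a * circleMap 0 r x‖ := by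
  rw [norm_one_sub_conj_mul_circleMap]
  have hρ0 : 0 ≤ ‖a‖ * r := by positivity
  have hρ1 : ‖a‖ * r ≤ 1 := by nlinarith [norm_nonneg a]
  have h4 := norm_ofReal_mul_exp_sub_exp hρ1 x
  have h5 := norm_sub_norm_le (Complex.exp (a.arg * Complex.I))
    (((‖a‖ * r : ℝ) : ℂ) * Complex.exp (x * Complex.I))
  rw [norm_mul, Complex.norm_exp_ofReal_mul_I, Complex.norm_exp_ofReal_mul_I, mul_one,
    Complex.norm_real, Real.norm_of_nonneg hρ0] at h5
  have h6 := norm_sub_le_norm_sub_add_norm_sub (Complex.exp (a.arg * Complex.I))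
    (((‖a‖ * r : ℝ) : ℂ) * Complex.exp (x * Complex.I)) (Complex.exp (x * Complex.I))
  rw [norm_sub_rev]
  linarith

theorem norm_one_sub_conj_mul_circleMap_le (a : ℂ) (ha : ‖a‖ ≤ 1) {r : ℝ} (hr0 : 0 ≤ r)
    (hr1 : r ≤ 1) (x : ℝ) : ‖1 - conj a * circleMap 0 r x‖
      ≤ ‖Complex.exp (x * Complex.I) - Complex.exp (a.arg * Complex.I)‖
        + (1 - ‖a‖) + (1 - r) := by
  rw [norm_one_sub_conj_mul_circleMap]
  have hρ1 : ‖a‖ * r ≤ 1 := by nlinarith [norm_nonneg a]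
  have h4 := norm_ofReal_mul_exp_sub_exp hρ1 x
  have h6 := norm_sub_le_norm_sub_add_norm_sub (Complex.exp (a.arg * Complex.I))
    (Complex.exp (x * Complex.I)) (((‖a‖ * r : ℝ) : ℂ) * Complex.exp (x * Complex.I))
  rw [norm_sub_rev (Complex.exp (x * Complex.I)) (((‖a‖ * r : ℝ) : ℂ) * _), h4,
    norm_sub_rev _ (Complex.exp (x * Complex.I))] at h6
  nlinarith [mul_nonneg (sub_nonneg.2 ha) (sub_nonneg.2 hr1)]

/-! ### Exponential Blaschke products have derivative in weak `H¹` -/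

theorem IsBlaschkeProductOf.memWeakHardy_deriv {ι : Type*} [Countable ι] {z : ι → ℂ} {B : ℂ → ℂ}
    (h : IsBlaschkeProductOf z B) (hB : HasExponentialZeros B) : MemWeakHardy (deriv B) 1 := by
  refine ⟨h.differentiableOn.deriv isOpen_ball, ?_⟩
  obtain ⟨M, hM0, hM⟩ := h.exists_card_le_of_hasExponentialZeros hB
  have hM1 : (1 : ℝ) ≤ M := by exact_mod_cast hM0
  -- The strict lower bound makes the half-open levels disjoint, so every zero has a single level `κ
  -- i`.
  have hlev : ∀ i, ∃ k : ℕ, (1 / 2 : ℝ) ^ (k + 1) < 1 - ‖z i‖ ∧ 1 - ‖z i‖ ≤ (1 / 2 : ℝ) ^ k :=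
    fun i => exists_nat_pow_near_of_lt_one (by linarith [h.norm_lt i])
      (by linarith [norm_nonneg (z i)]) (by norm_num) (by norm_num)
  choose κ hκ using hlev
  replace hM : ∀ k, ∀ F : Finset ι, (∀ i ∈ F, κ i = k) → F.card ≤ M := fun k F hF =>
    hM k F fun i hi => by
      rw [← hF i hi]
      exact ⟨(hκ i).1.le, (hκ i).2⟩
  -- `4864 = 32 * 2 * 76`: the discarded length is at most `32 M 2^(-K)`, and `t < 2^(K+1) * 76 M`.
  -- For `t < 76 M` the length of the whole circle suffices.
  refine ⟨4864 * M ^ 2, by positivity, fun r hr0 hr1 t ht => ?_⟩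
  rw [Real.rpow_neg_one]
  rcases lt_or_ge t (76 * M) with hsmall | hlarge
  · calc _ ≤ MeasureTheory.volume (Set.Ico 0 (2 * Real.pi)) :=
          MeasureTheory.measure_mono fun x hx => hx.1
      _ ≤ _ := by
          rw [Real.volume_Ico]
          refine ENNReal.ofReal_le_ofReal ?_
          rw [← div_eq_mul_inv, le_div_iff₀ ht]
          nlinarith [Real.pi_le_four, Real.pi_pos]
  have h76 : (0 : ℝ) < 76 * M := by positivity
  obtain ⟨K, hK1, hK2⟩ := exists_nat_pow_near (x := t / (76 * M)) (y := (2 : ℝ))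
    (by rwa [one_le_div h76]) (by norm_num)
  rw [le_div_iff₀ h76] at hK1
  rw [div_lt_iff₀ h76] at hK2
  -- Radii of the discarded arcs. The ratio `q = 3/4` needs `q < 1` for a summable length and `q² >
  -- 1/2` for `2^(-k) / s k ^ 2` to be summable.
  set s : ℕ → ℝ := fun k => if k < K then 0 else (1 / 2) ^ K * (3 / 4) ^ (k - K) with hs
  have hs0 : ∀ k, 0 ≤ s k := fun k => by simp only [hs]; split_ifs <;> positivity
  have hsum_s : ∀ n, ∑ k ∈ Finset.range n, 8 * s k ≤ 32 * (1 / 2) ^ K := fun n => by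
    refine (sum_range_le_sum_add_sum (fun k => mul_nonneg (by norm_num) (hs0 k)) K n).trans ?_
    rw [Finset.sum_eq_zero fun k hk => by simp [hs, Finset.mem_range.1 hk], zero_add]
    have h1 : ∀ j, 8 * s (K + j) = 8 * (1 / 2) ^ K * (3 / 4) ^ j := fun j => by
      simp [hs]; ring
    simp_rw [h1]
    rw [← Finset.mul_sum]
    have h2 := sum_range_pow_le (q := 3 / 4) (by norm_num) (by norm_num) n
    have h3 : (0 : ℝ) < (1 / 2) ^ K := by positivity
    nlinarith
  -- Bound for a term of level `k` off its arc. For `k ≥ K` it is `2 * 2^(-k) / (s k / 2)^2`, with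
  -- ratio `(1/2) / (3/4)² = 8/9`. The total is at most `(4 + 8 * 9) 2^K`.
  set g : ℕ → ℝ := fun k => if k < K then 4 * 2 ^ k else 8 * 2 ^ K * (8 / 9) ^ (k - K) with hgdef
  have hg0 : ∀ k, 0 ≤ g k := fun k => by simp only [hgdef]; split_ifs <;> positivity
  have hsum_g : ∀ n, ∑ k ∈ Finset.range n, g k ≤ 76 * 2 ^ K := fun n => by
    refine (sum_range_le_sum_add_sum hg0 K n).trans ?_
    have h0 : ∑ k ∈ Finset.range K, g k ≤ 4 * 2 ^ K := by
      rw [Finset.sum_congr rfl (g := fun k => 4 * (2 : ℝ) ^ k)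
        fun k hk => by simp [hgdef, Finset.mem_range.1 hk], ← Finset.mul_sum,
        geom_sum_eq (by norm_num)]
      linarith
    have h1 : ∀ j, g (K + j) = 8 * 2 ^ K * (8 / 9) ^ j := fun j => by simp [hgdef]
    simp_rw [h1]
    rw [← Finset.mul_sum]
    have h2 := sum_range_pow_le (q := 8 / 9) (by norm_num) (by norm_num) n
    have h3 : (0 : ℝ) < 2 ^ K := by positivity
    nlinarith
  set A : ι → Set ℝ := fun i => {x : ℝ | x ∈ Set.Ico 0 (2 * Real.pi) ∧
    ‖Complex.exp (x * Complex.I) - Complex.exp ((z i).arg * Complex.I)‖ < s (κ i)} with hA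
  have hterm : ∀ x ∈ Set.Ico 0 (2 * Real.pi), ∀ i, x ∉ A i →
      (1 - ‖z i‖ ^ 2) / ‖1 - conj (z i) * circleMap 0 r x‖ ^ 2 ≤ g (κ i) := fun x hx i hxi => by
    have hi := h.norm_lt i
    have hw : ‖circleMap 0 r x‖ < 1 := by
      rw [norm_circleMap_zero, abs_of_pos hr0]; exact hr1
    have hd : 0 < 1 - ‖z i‖ := by linarith
    have hnum : 1 - ‖z i‖ ^ 2 ≤ 2 * (1 - ‖z i‖) := by nlinarith [norm_nonneg (z i)]
    have hden := one_sub_norm_le_norm_one_sub_conj_mul (a := z i) hw.le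
    have hden0 : 0 < ‖1 - conj (z i) * circleMap 0 r x‖ := hd.trans_le hden
    rw [div_le_iff₀ (by positivity)]
    refine hnum.trans ?_
    simp only [hgdef]
    split_ifs with hk
    · have h1 : 1 ≤ 2 ^ (κ i + 1) * (1 - ‖z i‖) := by
        have := (hκ i).1
        rw [one_div, inv_pow, inv_lt_iff_one_lt_mul₀' (by positivity)] at this
        exact this.le
      have h2 : (1 - ‖z i‖) ^ 2 ≤ ‖1 - conj (z i) * circleMap 0 r x‖ ^ 2 := by gcongr
      calc 2 * (1 - ‖z i‖) ≤ 2 * (1 - ‖z i‖) * (2 ^ (κ i + 1) * (1 - ‖z i‖)) :=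
            le_mul_of_one_le_right (by positivity) h1
        _ = 4 * 2 ^ κ i * (1 - ‖z i‖) ^ 2 := by ring
        _ ≤ _ := by gcongr
    · have h1 : s (κ i) ≤ 2 * ‖1 - conj (z i) * circleMap 0 r x‖ := by
        refine le_trans ?_ (norm_exp_sub_exp_arg_le (z i) hi.le hr0.le hr1.le x)
        by_contra hcon
        exact hxi ⟨hx, not_le.1 hcon⟩
      have h2 : s (κ i) ^ 2 ≤ 4 * ‖1 - conj (z i) * circleMap 0 r x‖ ^ 2 := by
        nlinarith [hs0 (κ i)]
      obtain ⟨j, hj⟩ := Nat.exists_eq_add_of_le (not_lt.1 hk)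
      have hs' : s (κ i) = (1 / 2) ^ K * (3 / 4) ^ j := by simp [hs, hj]
      have h3 := (hκ i).2
      rw [hs'] at h2
      rw [hj] at h3 ⊢
      rw [Nat.add_sub_cancel_left]
      have h4 : (2 : ℝ) ^ K * (1 / 2) ^ K = 1 := by rw [← mul_pow]; norm_num
      have h5 : (8 / 9 : ℝ) ^ j * ((3 / 4) ^ j) ^ 2 = (1 / 2) ^ j := by
        rw [← pow_mul, mul_comm j 2, pow_mul, ← mul_pow]; norm_num
      calc 2 * (1 - ‖z i‖) ≤ 2 * (1 / 2) ^ (K + j) := by gcongr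
        _ = 2 * (2 ^ K * (1 / 2) ^ K) * (1 / 2) ^ K
              * ((8 / 9 : ℝ) ^ j * ((3 / 4) ^ j) ^ 2) := by
            rw [h4, h5, pow_add]; ring
        _ = 2 * 2 ^ K * (8 / 9) ^ j * ((1 / 2) ^ K * (3 / 4) ^ j) ^ 2 := by ring
        _ ≤ 2 * 2 ^ K * (8 / 9) ^ j * (4 * ‖1 - conj (z i) * circleMap 0 r x‖ ^ 2) := by gcongr
        _ = _ := by ring
  have hsub : {x : ℝ | x ∈ Set.Ico 0 (2 * Real.pi) ∧ t < ‖deriv B (circleMap 0 r x)‖}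
      ⊆ ⋃ i, A i := by
    rintro x ⟨hx, hxt⟩
    by_contra hcon
    simp only [Set.mem_iUnion, not_exists] at hcon
    refine absurd hxt (not_lt.2 (h.norm_deriv_le_of_sum_le ?_ fun F => ?_))
    · rw [norm_circleMap_zero, abs_of_pos hr0]; exact hr1
    calc _ ≤ ∑ i ∈ F, g (κ i) := Finset.sum_le_sum fun i _ => hterm x hx i (hcon i)
      _ ≤ M * (76 * 2 ^ K) := sum_comp_le_of_card_le hM hg0 hsum_g F
      _ ≤ t := by linarith
  refine (MeasureTheory.measure_mono hsub).trans ((MeasureTheory.measure_iUnion_le _).trans ?_)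
  rw [ENNReal.tsum_eq_iSup_sum]
  refine iSup_le fun F => ?_
  calc ∑ i ∈ F, MeasureTheory.volume (A i) ≤ ∑ i ∈ F, ENNReal.ofReal (8 * s (κ i)) :=
        Finset.sum_le_sum fun i _ => volume_arc_le (Complex.arg_mem_Ioc _) (hs0 _)
    _ = ENNReal.ofReal (∑ i ∈ F, 8 * s (κ i)) :=
        (ENNReal.ofReal_sum_of_nonneg fun i _ => mul_nonneg (by norm_num) (hs0 _)).symm
    _ ≤ _ := by
        refine ENNReal.ofReal_le_ofReal ?_
        refine (sum_comp_le_of_card_le (g := fun k => 8 * s k) hM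
          (fun k => mul_nonneg (by norm_num) (hs0 k)) hsum_s F).trans ?_
        rw [← div_eq_mul_inv, le_div_iff₀ ht]
        have h4 : (2 : ℝ) ^ K * (1 / 2) ^ K = 1 := by rw [← mul_pow]; norm_num
        calc (M : ℝ) * (32 * (1 / 2) ^ K) * t
            ≤ M * (32 * (1 / 2) ^ K) * (2 ^ (K + 1) * (76 * M)) := by gcongr
          _ = 4864 * M ^ 2 * (2 ^ K * (1 / 2) ^ K) := by ring
          _ = _ := by rw [h4, mul_one]

/-! ### Boundary behaviour of a Blaschke product in the mean -/

theorem one_sub_sum_one_sub_le_prod {ι : Type*} (F : Finset ι) {x : ι → ℝ} (h0 : ∀ i, 0 ≤ x i)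
    (h1 : ∀ i, x i ≤ 1) : 1 - ∑ i ∈ F, (1 - x i) ≤ ∏ i ∈ F, x i := by
  classical
  induction F using Finset.induction_on with
  | empty => simp
  | insert i F hi ih =>
    rw [Finset.sum_insert hi, Finset.prod_insert hi]
    have h2 : ∏ j ∈ F, x j ≤ 1 := Finset.prod_le_one (fun j _ => h0 j) fun j _ => h1 j
    nlinarith [h0 i, h1 i, mul_nonneg (sub_nonneg.2 (h1 i)) (sub_nonneg.2 h2)]

theorem norm_circleMap_zero_lt_one {r : ℝ} (h0 : 0 ≤ r) (h1 : r < 1) (x : ℝ) :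
    ‖circleMap 0 r x‖ < 1 := by
  rwa [norm_circleMap_zero, abs_of_nonneg h0]

namespace IsBlaschkeProductOf

variable {ι : Type*} {z : ι → ℂ} {B : ℂ → ℂ}

theorem continuous_comp_circleMap (h : IsBlaschkeProductOf z B) {R : ℝ} (h0 : 0 ≤ R)
    (h1 : R < 1) : Continuous fun x => B (circleMap 0 R x) :=
  h.differentiableOn.continuousOn.comp_continuous (continuous_circleMap 0 R)
    fun x => mem_ball_zero_iff.2 (norm_circleMap_zero_lt_one h0 h1 x)

theorem one_sub_tsum_le_norm_zero (h : IsBlaschkeProductOf z B) :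
    1 - ∑' i, (1 - ‖z i‖) ≤ ‖B 0‖ := by
  refine ge_of_tendsto (h.hasProd 0 (by simp)).norm (Eventually.of_forall fun F => ?_)
  simp only [norm_blaschkeFactor_zero]
  have h1 := one_sub_sum_one_sub_le_prod F (fun i => norm_nonneg (z i))
    fun i => (h.norm_lt i).le
  have h2 := h.summable.sum_le_tsum F fun i _ => sub_nonneg.2 (h.norm_lt i).le
  linarith

theorem two_pi_mul_norm_zero_le (h : IsBlaschkeProductOf z B) {R : ℝ} (h0 : 0 ≤ R) (h1 : R < 1) :
    2 * Real.pi * ‖B 0‖ ≤ ∫ x in (0 : ℝ)..2 * Real.pi, ‖B (circleMap 0 R x)‖ := by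
  have hd : DiffContOnCl ℂ B (ball 0 |R|) := by
    refine DifferentiableOn.diffContOnCl_ball (h.differentiableOn) ?_
    rw [abs_of_nonneg h0]
    exact closedBall_subset_ball h1
  have h2 := hd.circleAverage
  rw [Real.circleAverage_def] at h2
  have hpi := Real.two_pi_pos
  rw [← h2, norm_smul, Real.norm_of_nonneg (by positivity), ← mul_assoc,
    mul_inv_cancel₀ hpi.ne', one_mul]
  exact intervalIntegral.norm_integral_le_integral_norm hpi.le

theorem one_sub_norm_blaschkeFactor_le {a w : ℂ} (ha : ‖a‖ < 1) (hw : ‖w‖ < 1) :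
    1 - ‖blaschkeFactor a w‖ ≤ 4 / (1 - ‖a‖) * (1 - ‖w‖) := by
  have h1 := one_sub_normSq_blaschkeFactor ha hw
  have h2 := norm_blaschkeFactor_le_one ha hw
  have h3 := one_sub_norm_le_norm_one_sub_conj_mul (a := a) hw.le
  have ha' : 0 < 1 - ‖a‖ := by linarith
  have hw' : 0 < 1 - ‖w‖ := by linarith
  have h4 : (1 - ‖a‖ ^ 2) * (1 - ‖w‖ ^ 2) ≤ (2 * (1 - ‖a‖)) * (2 * (1 - ‖w‖)) := by
    refine mul_le_mul ?_ ?_ ?_ ?_ <;> nlinarith [norm_nonneg a, norm_nonneg w]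
  calc 1 - ‖blaschkeFactor a w‖ ≤ 1 - ‖blaschkeFactor a w‖ ^ 2 := by
        nlinarith [norm_nonneg (blaschkeFactor a w)]
    _ ≤ (2 * (1 - ‖a‖)) * (2 * (1 - ‖w‖)) / (1 - ‖a‖) ^ 2 := by rw [h1]; gcongr
    _ = _ := by field_simp; ring

/-- The mean of `1 - ‖B‖` over circles tends to zero at the boundary. -/
theorem eventually_lintegral_one_sub_norm_le (h : IsBlaschkeProductOf z B) {ε : ℝ} (hε : 0 < ε) :
    ∀ᶠ R in 𝓝[<] (1 : ℝ), ∫⁻ x in Set.Ico 0 (2 * Real.pi),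
      ENNReal.ofReal (1 - ‖B (circleMap 0 R x)‖) ≤ ENNReal.ofReal ε := by
  classical
  have hpi := Real.two_pi_pos
  -- One `η` pays for the tail product `S`, through `‖S 0‖ ≥ 1 - η` and the mean value property; the
  -- other for the finite product, uniformly close to modulus 1 near the circle.
  set η := ε / (2 * Real.pi) / 2 with hη
  have hη0 : 0 < η := by positivity
  obtain ⟨F, hF⟩ : ∃ F : Finset ι, ∑' i : {i // i ∉ F}, (1 - ‖z i‖) < η :=
    ((tendsto_tsum_compl_atTop_zero fun i => 1 - ‖z i‖).eventually (gt_mem_nhds hη0)).exists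
  obtain ⟨S, hS, hBS⟩ := h.exists_eq_prod_mul F
  set c := ∑ i ∈ F, 4 / (1 - ‖z i‖) with hc
  have hc0 : 0 ≤ c := Finset.sum_nonneg fun i _ =>
    div_nonneg (by norm_num) (sub_nonneg.2 (h.norm_lt i).le)
  have hlim : Tendsto (fun R : ℝ => c * (1 - R)) (𝓝[<] 1) (𝓝 0) := by
    have : Tendsto (fun R : ℝ => c * (1 - R)) (𝓝 1) (𝓝 (c * (1 - 1))) := by
      apply Continuous.tendsto; fun_prop
    rw [sub_self, mul_zero] at this
    exact this.mono_left nhdsWithin_le_nhds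
  filter_upwards [hlim.eventually (gt_mem_nhds hη0), self_mem_nhdsWithin,
    nhdsWithin_le_nhds (lt_mem_nhds zero_lt_one)] with R hR hR1 hR0
  have hlow : ∀ x, ‖S (circleMap 0 R x)‖ - η ≤ ‖B (circleMap 0 R x)‖ := fun x => by
    have hw := norm_circleMap_zero_lt_one hR0.le hR1 x
    have hn : ‖circleMap 0 R x‖ = R := by rw [norm_circleMap_zero, abs_of_pos hR0]
    rw [hBS _ (mem_ball_zero_iff.2 hw), norm_mul, norm_prod]
    have h1 := one_sub_sum_one_sub_le_prod F
      (x := fun i => ‖blaschkeFactor (z i) (circleMap 0 R x)‖) (fun i => norm_nonneg _)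
      fun i => norm_blaschkeFactor_le_one (h.norm_lt i) hw
    have h2 : ∑ i ∈ F, (1 - ‖blaschkeFactor (z i) (circleMap 0 R x)‖) ≤ c * (1 - R) := by
      rw [hc, Finset.sum_mul]
      refine Finset.sum_le_sum fun i _ => ?_
      have := one_sub_norm_blaschkeFactor_le (h.norm_lt i) hw
      rwa [hn] at this
    have h3 := hS.norm_le_one hw
    nlinarith [norm_nonneg (S (circleMap 0 R x))]
  have hcB := (h.continuous_comp_circleMap hR0.le hR1).norm
  have hcS := (hS.continuous_comp_circleMap hR0.le hR1).norm
  have h1 : 2 * Real.pi * (1 - 2 * η)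
      ≤ ∫ x in (0 : ℝ)..2 * Real.pi, ‖B (circleMap 0 R x)‖ := by
    calc 2 * Real.pi * (1 - 2 * η)
        ≤ (∫ x in (0 : ℝ)..2 * Real.pi, ‖S (circleMap 0 R x)‖) - 2 * Real.pi * η := by
          have h2 := hS.two_pi_mul_norm_zero_le hR0.le hR1
          have h3 := hS.one_sub_tsum_le_norm_zero
          have h4 : 2 * Real.pi * (1 - η) ≤ 2 * Real.pi * ‖S 0‖ := by
            gcongr; linarith
          linarith
      _ = ∫ x in (0 : ℝ)..2 * Real.pi, (‖S (circleMap 0 R x)‖ - η) := by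
          rw [intervalIntegral.integral_sub (hcS.intervalIntegrable _ _)
            (by simp)]
          simp
      _ ≤ _ := intervalIntegral.integral_mono_on hpi.le
          ((hcS.sub continuous_const).intervalIntegrable _ _) (hcB.intervalIntegrable _ _)
          fun x _ => hlow x
  have hcont : Continuous fun x => 1 - ‖B (circleMap 0 R x)‖ := continuous_const.sub hcB
  rw [← ofReal_integral_eq_lintegral_ofReal]
  · refine ENNReal.ofReal_le_ofReal ?_
    rw [integral_Ico_eq_integral_Ioc, ← intervalIntegral.integral_of_le hpi.le,
      intervalIntegral.integral_sub (by simp) (hcB.intervalIntegrable _ _)]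
    have h5 : 2 * Real.pi * (2 * η) = ε := by rw [hη]; field_simp
    simp only [intervalIntegral.integral_const, sub_zero, smul_eq_mul, mul_one]
    linarith
  · exact (hcont.integrableOn_Icc (a := 0) (b := 2 * Real.pi)).mono_set Set.Ico_subset_Icc_self
  · exact Eventually.of_forall fun x =>
      sub_nonneg.2 (h.norm_le_one (norm_circleMap_zero_lt_one hR0.le hR1 x))

/-! ### Integrating the derivative along radii -/

theorem enorm_sub_le_lintegral_deriv (h : IsBlaschkeProductOf z B) {r R : ℝ} (hr0 : 0 ≤ r)
    (hrR : r ≤ R) (hR1 : R < 1) (x : ℝ) :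
    ‖B (circleMap 0 R x) - B (circleMap 0 r x)‖ₑ
      ≤ ∫⁻ s in Set.Ioc r R, ‖deriv B (circleMap 0 s x)‖ₑ := by
  set e := Complex.exp (x * Complex.I) with he
  have hcm : ∀ s : ℝ, circleMap 0 s x = s * e := fun s => by simp [circleMap, he]
  have hin : ∀ s ∈ Set.uIcc r R, circleMap 0 s x ∈ ball (0 : ℂ) 1 := fun s hs => by
    rw [Set.uIcc_of_le hrR] at hs
    exact mem_ball_zero_iff.2
      (norm_circleMap_zero_lt_one (hr0.trans hs.1) (hs.2.trans_lt hR1) x)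
  have hpath : ∀ s : ℝ, HasDerivAt (fun s : ℝ => circleMap 0 s x) e s := fun s => by
    simp only [hcm]
    simpa using (Complex.ofRealCLM.hasDerivAt (x := s)).mul_const e
  have hder : ∀ s ∈ Set.uIcc r R, HasDerivAt (fun s : ℝ => B (circleMap 0 s x))
      (deriv B (circleMap 0 s x) * e) s := fun s hs =>
    ((h.differentiableOn.differentiableAt
      (isOpen_ball.mem_nhds (hin s hs))).hasDerivAt).comp s (hpath s)
  have hcont : ContinuousOn (fun s : ℝ => deriv B (circleMap 0 s x) * e) (Set.uIcc r R) :=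
    (((h.differentiableOn.deriv isOpen_ball).continuousOn).comp
      (fun s _ => (hpath s).continuousAt.continuousWithinAt) hin).mul continuousOn_const
  rw [← intervalIntegral.integral_eq_sub_of_hasDerivAt hder hcont.intervalIntegrable,
    intervalIntegral.integral_of_le hrR]
  refine (enorm_integral_le_lintegral_enorm _).trans (le_of_eq ?_)
  refine lintegral_congr fun s => ?_
  rw [enorm_mul, he, ← ofReal_norm (Complex.exp _), Complex.norm_exp_ofReal_mul_I,
    ENNReal.ofReal_one, mul_one]

theorem ofReal_one_sub_norm_le (h : IsBlaschkeProductOf z B) {r R : ℝ} (hr0 : 0 ≤ r)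
    (hrR : r ≤ R) (hR1 : R < 1) (x : ℝ) :
    ENNReal.ofReal (1 - ‖B (circleMap 0 r x)‖)
      ≤ ENNReal.ofReal (1 - ‖B (circleMap 0 R x)‖)
        + ∫⁻ s in Set.Ioc r R, ‖deriv B (circleMap 0 s x)‖ₑ := by
  refine le_trans ?_ (add_le_add_right (h.enorm_sub_le_lintegral_deriv hr0 hrR hR1 x) _)
  have h1 := h.norm_le_one (norm_circleMap_zero_lt_one (hr0.trans hrR) hR1 x)
  rw [← ofReal_norm, ← ENNReal.ofReal_add (by linarith) (norm_nonneg _)]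
  refine ENNReal.ofReal_le_ofReal ?_
  have := norm_sub_norm_le (B (circleMap 0 R x)) (B (circleMap 0 r x))
  linarith

theorem lintegral_ofReal_one_sub_norm_le (h : IsBlaschkeProductOf z B) {r R : ℝ} (hr0 : 0 ≤ r)
    (hrR : r ≤ R) (hR1 : R < 1) (E : Set ℝ) :
    ∫⁻ x in E, ENNReal.ofReal (1 - ‖B (circleMap 0 r x)‖)
      ≤ (∫⁻ x in E, ENNReal.ofReal (1 - ‖B (circleMap 0 R x)‖))
        + ∫⁻ s in Set.Ioc r R, ∫⁻ x in E, ‖deriv B (circleMap 0 s x)‖ₑ := by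
  have hmeas : Measurable fun p : ℝ × ℝ => ‖deriv B (circleMap 0 p.2 p.1)‖ₑ := by
    refine ((measurable_deriv B).comp (Continuous.measurable ?_)).enorm
    unfold circleMap
    fun_prop
  refine (lintegral_mono fun x => h.ofReal_one_sub_norm_le hr0 hrR hR1 x).trans ?_
  have hB : Measurable fun x => ENNReal.ofReal (1 - ‖B (circleMap 0 R x)‖) :=
    (measurable_const.sub
      (h.continuous_comp_circleMap (hr0.trans hrR) hR1).norm.measurable).ennreal_ofReal
  rw [lintegral_add_left hB, lintegral_lintegral_swap hmeas.aemeasurable]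

end IsBlaschkeProductOf

/-! ### Truncated weak-type integrals -/

/-- Layer cake: the distribution function is at most `volume E` for `t ≤ a`, at most `C / t` between
`a` and `T`, and zero beyond `T`. -/
theorem lintegral_le_of_weak_type {E : Set ℝ} {f : ℝ → ℝ} (hf : Measurable f)
    (hf0 : ∀ x, 0 ≤ f x) {C a T : ℝ} (hC : 0 ≤ C) (ha : 0 < a) (haT : a ≤ T)
    (hT : ∀ x ∈ E, f x ≤ T) (hE : MeasurableSet E)
    (hw : ∀ t, 0 < t → volume {x | x ∈ E ∧ t < f x} ≤ ENNReal.ofReal (C * t⁻¹)) :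
    ∫⁻ x in E, ENNReal.ofReal (f x)
      ≤ ENNReal.ofReal a * volume E + ENNReal.ofReal (C * Real.log (T / a)) := by
  rw [lintegral_eq_lintegral_meas_lt _ (Eventually.of_forall hf0) hf.aemeasurable]
  have hset : ∀ t, (volume.restrict E) {x | t < f x} = volume {x | x ∈ E ∧ t < f x} := fun t => by
    rw [Measure.restrict_apply' hE]
    congr 1
    ext x
    simp [and_comm]
  simp_rw [hset]
  have hsplit : Set.Ioi (0 : ℝ) = (Set.Ioc 0 a ∪ Set.Ioc a T) ∪ Set.Ioi T := by
    rw [Set.Ioc_union_Ioc_eq_Ioc ha.le haT, Set.Ioc_union_Ioi_eq_Ioi (ha.le.trans haT)]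
  rw [hsplit]
  refine (lintegral_union_le _ _ _).trans ?_
  have h3 : ∫⁻ t in Set.Ioi T, volume {x | x ∈ E ∧ t < f x} = 0 := by
    refine setLIntegral_eq_zero measurableSet_Ioi fun t ht => ?_
    have : {x | x ∈ E ∧ t < f x} = ∅ :=
      Set.eq_empty_of_forall_notMem fun x hx =>
        absurd hx.2 (not_lt.2 ((hT x hx.1).trans (le_of_lt ht)))
    simp [this]
  rw [h3, add_zero]
  refine (lintegral_union_le _ _ _).trans (add_le_add ?_ ?_)
  · calc _ ≤ ∫⁻ _ in Set.Ioc 0 a, volume E :=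
          lintegral_mono fun t => measure_mono fun x hx => hx.1
      _ = _ := by rw [setLIntegral_const, Real.volume_Ioc, sub_zero, mul_comm]
  · have hint : IntervalIntegrable (fun t : ℝ => C * t⁻¹) volume a T :=
      (intervalIntegrable_inv_iff.2
        (Or.inr (Set.notMem_uIcc_of_lt ha (ha.trans_le haT)))).const_mul C
    calc _ ≤ ∫⁻ t in Set.Ioc a T, ENNReal.ofReal (C * t⁻¹) :=
          setLIntegral_mono' measurableSet_Ioc fun t ht => hw t (ha.trans ht.1)
      _ = ENNReal.ofReal (∫ t in Set.Ioc a T, C * t⁻¹) := by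
          refine (ofReal_integral_eq_lintegral_ofReal
            ((intervalIntegrable_iff_integrableOn_Ioc_of_le haT).1 hint) ?_).symm
          filter_upwards [ae_restrict_mem measurableSet_Ioc] with t ht
          have : 0 < t := ha.trans ht.1
          positivity
      _ ≤ _ := by
          rw [← intervalIntegral.integral_of_le haT, intervalIntegral.integral_const_mul,
            integral_inv_of_pos ha (ha.trans_le haT)]

theorem lintegral_inv_sqrt_one_sub_le {r R : ℝ} (hrR : r ≤ R) (hR : R < 1) :
    ∫⁻ s in Set.Ioc r R, ENNReal.ofReal (Real.sqrt (1 - s))⁻¹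
      ≤ ENNReal.ofReal (2 * Real.sqrt (1 - r)) := by
  have hpos : ∀ s ∈ Set.uIcc r R, 0 < 1 - s := fun s hs => by
    rw [Set.uIcc_of_le hrR] at hs
    linarith [hs.2]
  have hder : ∀ s ∈ Set.uIcc r R,
      HasDerivAt (fun s => -2 * Real.sqrt (1 - s)) (Real.sqrt (1 - s))⁻¹ s := fun s hs => by
    have h1 : HasDerivAt (fun s : ℝ => 1 - s) (-1) s := by
      simpa using (hasDerivAt_id s).const_sub 1
    refine ((h1.sqrt (hpos s hs).ne').const_mul (-2)).congr_deriv ?_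
    have := Real.sqrt_pos.2 (hpos s hs)
    field_simp
  have hcont : ContinuousOn (fun s => (Real.sqrt (1 - s))⁻¹) (Set.uIcc r R) :=
    ContinuousOn.inv₀ (by fun_prop) fun s hs => (Real.sqrt_pos.2 (hpos s hs)).ne'
  rw [← ofReal_integral_eq_lintegral_ofReal
    ((intervalIntegrable_iff_integrableOn_Ioc_of_le hrR).1 hcont.intervalIntegrable)
    (Eventually.of_forall fun s => by positivity)]
  refine ENNReal.ofReal_le_ofReal ?_
  rw [← intervalIntegral.integral_of_le hrR,
    intervalIntegral.integral_eq_sub_of_hasDerivAt hder hcont.intervalIntegrable]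
  have := Real.sqrt_nonneg (1 - R)
  linarith

theorem log_le_two_mul_sqrt {x : ℝ} (hx : 0 < x) : Real.log x ≤ 2 * Real.sqrt x := by
  have h1 := Real.log_le_sub_one_of_pos (Real.sqrt_pos.2 hx)
  rw [Real.log_sqrt hx.le] at h1
  linarith

/-! ### Size of the set where `|B|` stays away from 1. -/

namespace IsBlaschkeProductOf

variable {ι : Type*} {z : ι → ℂ} {B : ℂ → ℂ}

theorem lintegral_deriv_le (h : IsBlaschkeProductOf z B) {C : ℝ} (hC : 0 < C)
    (hw : ∀ r : ℝ, 0 < r → r < 1 → ∀ t : ℝ, 0 < t →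
      volume {x : ℝ | x ∈ Set.Ico 0 (2 * Real.pi) ∧ t < ‖deriv B (circleMap 0 r x)‖}
        ≤ ENNReal.ofReal (C * t⁻¹))
    {a s : ℝ} (ha : 0 < a) (hs0 : 0 < s) (hs1 : s < 1) (has : a ≤ 2 / (1 - s)) {E : Set ℝ}
    (hE : MeasurableSet E) (hE' : E ⊆ Set.Ico 0 (2 * Real.pi)) :
    ∫⁻ x in E, ‖deriv B (circleMap 0 s x)‖ₑ
      ≤ ENNReal.ofReal a * volume E
        + ENNReal.ofReal (2 * C * Real.sqrt (2 / a)) * ENNReal.ofReal (Real.sqrt (1 - s))⁻¹ := by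
  have hs : 0 < 1 - s := by linarith
  have hmeas : Measurable fun x : ℝ => ‖deriv B (circleMap 0 s x)‖ :=
    ((measurable_deriv B).comp (continuous_circleMap 0 s).measurable).norm
  simp_rw [← ofReal_norm]
  refine (lintegral_le_of_weak_type hmeas (fun x => norm_nonneg _) hC.le ha has
    (fun x _ => ?_) hE fun t ht =>
      (measure_mono (fun x hx => And.intro (hE' hx.1) hx.2)).trans (hw s hs0 hs1 t ht)).trans ?_
  · have := h.norm_deriv_le (norm_circleMap_zero_lt_one hs0.le hs1 x)
    rwa [norm_circleMap_zero, abs_of_pos hs0] at this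
  · rw [← ENNReal.ofReal_mul (by positivity)]
    refine add_le_add le_rfl (ENNReal.ofReal_le_ofReal ?_)
    -- Trading the logarithm for a square root gives a majorant integrable in `s` up to 1, with an
    -- explicit primitive.
    have h1 := log_le_two_mul_sqrt (x := 2 / (1 - s) / a) (by positivity)
    have h2 : Real.sqrt (2 / (1 - s) / a) = Real.sqrt (2 / a) * (Real.sqrt (1 - s))⁻¹ := by
      rw [← Real.sqrt_inv, ← Real.sqrt_mul (by positivity)]
      congr 1
      field_simp
    rw [h2] at h1
    calc _ ≤ C * (2 * (Real.sqrt (2 / a) * (Real.sqrt (1 - s))⁻¹)) := by gcongr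
      _ = _ := by ring

/-- If `B'` is of weak type, a set of directions on which `B` stays away from the unit circle at
distance `1 - r` from the boundary has measure comparable to `1 - r`. -/
theorem volume_le_of_norm_le (h : IsBlaschkeProductOf z B) {C : ℝ} (hC : 0 < C)
    (hw : ∀ r : ℝ, 0 < r → r < 1 → ∀ t : ℝ, 0 < t →
      volume {x : ℝ | x ∈ Set.Ico 0 (2 * Real.pi) ∧ t < ‖deriv B (circleMap 0 r x)‖}
        ≤ ENNReal.ofReal (C * t⁻¹))
    {c r : ℝ} (hc0 : 0 < c) (hc1 : c ≤ 1) (hr0 : 0 < r) (hr1 : r < 1) {E : Set ℝ}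
    (hE : MeasurableSet E) (hE' : E ⊆ Set.Ico 0 (2 * Real.pi))
    (hB : ∀ x ∈ E, ‖B (circleMap 0 r x)‖ ≤ 1 - c) :
    (volume E).toReal ≤ 8 * C * Real.sqrt (4 / c) / c * (1 - r) := by
  have hfin : volume E ≠ ⊤ := measure_ne_top_of_subset hE' measure_Ico_lt_top.ne
  set v := (volume E).toReal with hv
  have hv0 : 0 ≤ v := ENNReal.toReal_nonneg
  have hvE : volume E = ENNReal.ofReal v := (ENNReal.ofReal_toReal hfin).symm
  have hr : 0 < 1 - r := by linarith
  -- Chosen so that `a * v * (1 - r) = c / 2 * v`, which is absorbed by `c * v` on the left.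
  set a := c / 2 / (1 - r) with ha
  have ha0 : 0 < a := by positivity
  set D := 2 * C * Real.sqrt (2 / a) with hD
  have hD0 : 0 ≤ D := by positivity
  have key : ∀ ε, 0 < ε → c * v ≤ ε + (c / 2 * v + D * (2 * Real.sqrt (1 - r))) := fun ε hε => by
    obtain ⟨R, ⟨hR, hrR⟩, hR1⟩ := ((h.eventually_lintegral_one_sub_norm_le hε).and
      (nhdsWithin_le_nhds (lt_mem_nhds hr1))).and self_mem_nhdsWithin |>.exists
    rw [← ENNReal.ofReal_le_ofReal_iff (by positivity)]
    calc ENNReal.ofReal (c * v) = ∫⁻ _ in E, ENNReal.ofReal c := by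
          rw [setLIntegral_const, hvE, ENNReal.ofReal_mul hc0.le]
      _ ≤ ∫⁻ x in E, ENNReal.ofReal (1 - ‖B (circleMap 0 r x)‖) :=
          setLIntegral_mono' hE fun x hx => ENNReal.ofReal_le_ofReal (by linarith [hB x hx])
      _ ≤ _ := h.lintegral_ofReal_one_sub_norm_le hr0.le hrR.le hR1 E
      _ ≤ ENNReal.ofReal ε + ∫⁻ s in Set.Ioc r R, (ENNReal.ofReal a * volume E
            + ENNReal.ofReal D * ENNReal.ofReal (Real.sqrt (1 - s))⁻¹) := by
          refine add_le_add ((lintegral_mono_set hE').trans hR)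
            (setLIntegral_mono' measurableSet_Ioc fun s hs => ?_)
          have hs1 : 0 < 1 - s := by linarith [hs.2]
          refine h.lintegral_deriv_le hC hw ha0 (hr0.trans hs.1) (hs.2.trans_lt hR1) ?_ hE hE'
          rw [ha, div_le_div_iff₀ hr hs1]
          nlinarith [hs.1]
      _ ≤ ENNReal.ofReal ε + (ENNReal.ofReal (a * v * (R - r))
            + ENNReal.ofReal D * ENNReal.ofReal (2 * Real.sqrt (1 - r))) := by
          rw [lintegral_add_left measurable_const, setLIntegral_const, Real.volume_Ioc, hvE,
            ← ENNReal.ofReal_mul ha0.le, ← ENNReal.ofReal_mul (by positivity),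
            lintegral_const_mul' _ _ ENNReal.ofReal_ne_top]
          gcongr
          exact lintegral_inv_sqrt_one_sub_le hrR.le hR1
      _ ≤ ENNReal.ofReal ε + (ENNReal.ofReal (c / 2 * v)
            + ENNReal.ofReal D * ENNReal.ofReal (2 * Real.sqrt (1 - r))) := by
          refine add_le_add le_rfl (add_le_add (ENNReal.ofReal_le_ofReal ?_) le_rfl)
          calc a * v * (R - r) ≤ a * v * (1 - r) := by gcongr
            _ = c / 2 * v := by rw [ha]; field_simp
      _ = _ := by
          rw [← ENNReal.ofReal_mul hD0, ← ENNReal.ofReal_add (by positivity) (by positivity),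
            ← ENNReal.ofReal_add hε.le (by positivity)]
  have h1 : c * v ≤ c / 2 * v + D * (2 * Real.sqrt (1 - r)) :=
    le_of_forall_pos_le_add fun ε hε => by linarith [key ε hε]
  -- `a` is proportional to `1 / (1 - r)`, so `D` supplies a second factor `√(1 - r)` and the bound
  -- becomes linear in `1 - r`.
  have h2 : D * (2 * Real.sqrt (1 - r)) = 4 * C * Real.sqrt (4 / c) * (1 - r) := by
    have h3 : Real.sqrt (2 / a) = Real.sqrt (4 / c) * Real.sqrt (1 - r) := by
      rw [← Real.sqrt_mul (by positivity), ha]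
      congr 1
      field_simp
      norm_num
    rw [hD, h3]
    linear_combination (4 * C * Real.sqrt (4 / c)) * Real.mul_self_sqrt hr.le
  rw [h2] at h1
  rw [div_mul_eq_mul_div, le_div_iff₀ hc0]
  linarith

/-! ### Many zeros in a dyadic cell force `B` to be small nearby -/

/-- At `1 - r = 2^(-k) / m` each of the `m` zeros lowers `‖B‖²` by a factor `1 - const / m`, so
together they gain a constant independent of `m`. -/
theorem norm_le_of_card_le (h : IsBlaschkeProductOf z B) {k : ℕ} {G : Finset ι} {m : ℕ}
    (hm : 0 < m) (hk : 1 ≤ k) (hGm : m ≤ G.card) (hG : ∀ i ∈ G, z i ∈ dyadicAnnulus k) {x : ℝ}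
    (hx : ∀ i ∈ G, ‖Complex.exp (x * Complex.I) - Complex.exp ((z i).arg * Complex.I)‖
      ≤ 7 * (1 / 2) ^ k) :
    ‖B (circleMap 0 (1 - (1 / 2) ^ k / m) x)‖ ≤ 1 - 1 / 326 := by
  set δ : ℝ := (1 / 2) ^ k with hδ
  have hδ0 : 0 < δ := by positivity
  have hm' : (1 : ℝ) ≤ m := by exact_mod_cast hm
  have hm0 : (0 : ℝ) < m := by positivity
  have hδ1 : δ < 1 := pow_lt_one₀ (by norm_num) (by norm_num) (by omega)
  set r := 1 - δ / m with hr
  have hδm : δ / m ≤ δ := div_le_self hδ0.le hm'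
  have hδm0 : 0 < δ / m := by positivity
  have hr0 : 0 ≤ r := by linarith
  have hr1 : r < 1 := by linarith
  have hwn : ‖circleMap 0 r x‖ = r := by rw [norm_circleMap_zero, abs_of_nonneg hr0]
  have hw : ‖circleMap 0 r x‖ < 1 := by rwa [hwn]
  have hfac : ∀ i ∈ G, ‖blaschkeFactor (z i) (circleMap 0 r x)‖ ^ 2
      ≤ Real.exp (-(1 / (162 * m))) := fun i hi => by
    have h1 := h.norm_lt i
    obtain ⟨h2, h3⟩ := hG i hi
    rw [pow_succ, ← hδ] at h2
    rw [← hδ] at h3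
    -- `9 = 7 + 1 + 1`: the angle, `1 - ‖z i‖ ≤ δ` and `1 - r ≤ δ`. Then `162 = 2 * 9²`.
    have h4 : ‖1 - conj (z i) * circleMap 0 r x‖ ≤ 9 * δ := by
      refine (norm_one_sub_conj_mul_circleMap_le (z i) h1.le hr0 hr1.le x).trans ?_
      linarith [hx i hi]
    have h5 : 0 < ‖1 - conj (z i) * circleMap 0 r x‖ :=
      norm_pos_iff.2 (one_sub_conj_mul_ne_zero h1 hw)
    have h6 : 1 / (162 * m) ≤ 1 - ‖blaschkeFactor (z i) (circleMap 0 r x)‖ ^ 2 := by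
      rw [one_sub_normSq_blaschkeFactor h1 hw, hwn]
      calc 1 / (162 * (m : ℝ)) = (δ * (1 / 2)) * (δ / m) / (9 * δ) ^ 2 := by field_simp; norm_num
        _ ≤ (1 - ‖z i‖ ^ 2) * (1 - r ^ 2) / ‖1 - conj (z i) * circleMap 0 r x‖ ^ 2 := by
          have h7 : δ * (1 / 2) ≤ 1 - ‖z i‖ ^ 2 := by nlinarith [norm_nonneg (z i)]
          have h8 : δ / m ≤ 1 - r ^ 2 := by nlinarith
          have h9 : 0 ≤ 1 - ‖z i‖ ^ 2 := le_trans (by positivity) h7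
          have h10 : 0 ≤ 1 - r ^ 2 := hδm0.le.trans h8
          gcongr
    linarith [Real.one_sub_le_exp_neg (1 / (162 * (m : ℝ)))]
  have hsq : ‖B (circleMap 0 r x)‖ ^ 2 ≤ 162 / 163 := by
    calc ‖B (circleMap 0 r x)‖ ^ 2
        ≤ (∏ i ∈ G, ‖blaschkeFactor (z i) (circleMap 0 r x)‖) ^ 2 := by
          gcongr
          exact h.norm_le_norm_prod hw G
      _ = ∏ i ∈ G, ‖blaschkeFactor (z i) (circleMap 0 r x)‖ ^ 2 := (Finset.prod_pow _ _ _).symm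
      _ ≤ ∏ _i ∈ G, Real.exp (-(1 / (162 * m))) :=
          Finset.prod_le_prod (fun _ _ => by positivity) hfac
      _ = Real.exp (G.card * -(1 / (162 * m))) := by
          rw [Finset.prod_const, ← Real.exp_nat_mul]
      _ ≤ Real.exp (-(1 / 162)) := by
          refine Real.exp_le_exp.2 ?_
          have : (m : ℝ) ≤ G.card := by exact_mod_cast hGm
          rw [mul_neg, neg_le_neg_iff, mul_one_div, le_div_iff₀ (by positivity)]
          linarith
      _ ≤ 162 / 163 := by
          rw [Real.exp_neg, inv_le_comm₀ (Real.exp_pos _) (by norm_num)]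
          linarith [Real.add_one_le_exp (1 / 162 : ℝ)]
  -- `√(1 - 1/163) ≤ 1 - 1/326`.
  nlinarith [norm_nonneg (B (circleMap 0 r x)), h.norm_le_one hw]

end IsBlaschkeProductOf

/-! ### Dyadic cells of the circle -/

/-- The `l`-th of the `2 ^ k` equal half-open cells of `[0, 2π)`. -/
def circleCell (k l : ℕ) : Set ℝ :=
  Set.Ico (2 * Real.pi * (1 / 2) ^ k * l) (2 * Real.pi * (1 / 2) ^ k * (l + 1))

theorem measurableSet_circleCell (k l : ℕ) : MeasurableSet (circleCell k l) := measurableSet_Ico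

theorem volume_circleCell (k l : ℕ) :
    volume (circleCell k l) = ENNReal.ofReal (2 * Real.pi * (1 / 2) ^ k) := by
  rw [circleCell, Real.volume_Ico]
  congr 1
  ring

theorem disjoint_circleCell (k : ℕ) {l l' : ℕ} (h : l ≠ l') :
    Disjoint (circleCell k l) (circleCell k l') := by
  have hpos : 0 < 2 * Real.pi * (1 / 2) ^ k := by positivity
  wlog hlt : l < l' generalizing l l'
  · exact (this h.symm (by omega)).symm
  refine Set.disjoint_left.2 fun x hx hx' => ?_
  have h1 : (l : ℝ) + 1 ≤ l' := by exact_mod_cast hlt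
  have := mul_le_mul_of_nonneg_left h1 hpos.le
  linarith [hx.2, hx'.1]

theorem circleCell_subset {k l : ℕ} (h : l < 2 ^ k) :
    circleCell k l ⊆ Set.Ico 0 (2 * Real.pi) := by
  have hpi := Real.two_pi_pos
  have hpos : 0 < 2 * Real.pi * (1 / 2) ^ k := by positivity
  refine Set.Ico_subset_Ico (by positivity) ?_
  have h1 : (l : ℝ) + 1 ≤ 2 ^ k := by exact_mod_cast h
  have h4 : (1 / 2 : ℝ) ^ k * 2 ^ k = 1 := by rw [← mul_pow]; norm_num
  calc _ ≤ 2 * Real.pi * (1 / 2) ^ k * 2 ^ k := by gcongr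
    _ = _ := by rw [mul_assoc, h4, mul_one]

theorem exists_mem_circleCell (k : ℕ) {x : ℝ} (hx : x ∈ Set.Ico 0 (2 * Real.pi)) :
    ∃ l < 2 ^ k, x ∈ circleCell k l := by
  have hpos : 0 < 2 * Real.pi * (1 / 2) ^ k := by positivity
  have h4 : (2 : ℝ) ^ k * (1 / 2) ^ k = 1 := by rw [← mul_pow]; norm_num
  have hfl := Nat.floor_le (div_nonneg hx.1 hpos.le)
  rw [le_div_iff₀ hpos] at hfl
  have hlt := Nat.lt_floor_add_one (x / (2 * Real.pi * (1 / 2) ^ k))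
  rw [div_lt_iff₀ hpos] at hlt
  refine ⟨⌊x / (2 * Real.pi * (1 / 2) ^ k)⌋₊, ?_, by linarith, by linarith⟩
  rw [Nat.floor_lt (div_nonneg hx.1 hpos.le), div_lt_iff₀ hpos]
  push_cast
  calc x < 2 * Real.pi := hx.2
    _ = _ := by linear_combination (-2 * Real.pi) * h4

theorem norm_exp_sub_exp_le (x y : ℝ) :
    ‖Complex.exp (x * Complex.I) - Complex.exp (y * Complex.I)‖ ≤ |x - y| := by
  rw [norm_exp_sub_exp]
  have := Real.abs_sin_le_abs (x := (x - y) / 2)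
  rw [abs_div, abs_two] at this
  linarith

/-- Every point has a cell such that the cell is within `7 * 2 ^ (-k)` of its direction. -/
theorem exists_circleCell_near (k : ℕ) (a : ℂ) :
    ∃ l < 2 ^ k, ∀ x ∈ circleCell k l,
      ‖Complex.exp (x * Complex.I) - Complex.exp (a.arg * Complex.I)‖ ≤ 7 * (1 / 2) ^ k := by
  obtain ⟨y, hy, hya⟩ : ∃ y ∈ Set.Ico 0 (2 * Real.pi),
      Complex.exp (a.arg * Complex.I) = Complex.exp ((y : ℝ) * Complex.I) := by
    have h1 := Complex.neg_pi_lt_arg a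
    have h2 := Complex.arg_le_pi a
    have hpi := Real.pi_pos
    rcases lt_or_ge a.arg 0 with h | h
    · refine ⟨a.arg + 2 * Real.pi, ⟨by linarith, by linarith⟩, ?_⟩
      push_cast
      rw [add_mul, Complex.exp_add, Complex.exp_two_pi_mul_I, mul_one]
    · exact ⟨a.arg, ⟨h, by linarith⟩, rfl⟩
  obtain ⟨l, hl, hyl⟩ := exists_mem_circleCell k hy
  refine ⟨l, hl, fun x hx => ?_⟩
  rw [hya]
  refine (norm_exp_sub_exp_le x y).trans ?_
  have hpi : 2 * Real.pi ≤ 7 := by linarith [Real.pi_lt_d2]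
  have h3 : 2 * Real.pi * (1 / 2) ^ k ≤ 7 * (1 / 2 : ℝ) ^ k := by gcongr
  refine le_trans ?_ h3
  rw [abs_le]
  constructor <;> linarith [hx.1, hx.2, hyl.1, hyl.2]

/-! ### Blaschke products with derivative in weak `H¹` are exponential -/

namespace IsBlaschkeProductOf

variable {ι : Type*} {z : ι → ℂ} {B : ℂ → ℂ}

/-- Applies the measure bound to the union of the cells in `L`, of length `L.card * 2π * 2^(-k)`, at
`1 - r = 2^(-k) / m`. -/
theorem card_mul_le_of_forall_card_le (h : IsBlaschkeProductOf z B) {K : ℝ}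
    (hK : ∀ r : ℝ, 0 < r → r < 1 → ∀ E : Set ℝ, MeasurableSet E → E ⊆ Set.Ico 0 (2 * Real.pi) →
      (∀ x ∈ E, ‖B (circleMap 0 r x)‖ ≤ 1 - 1 / 326) → (volume E).toReal ≤ K * (1 - r))
    {k : ℕ} (hk : 1 ≤ k) {F : Finset ι} (hF : ∀ i ∈ F, z i ∈ dyadicAnnulus k) {l : ι → ℕ}
    (hl : ∀ i, l i < 2 ^ k) (hnear : ∀ i, ∀ x ∈ circleCell k (l i),
      ‖Complex.exp (x * Complex.I) - Complex.exp ((z i).arg * Complex.I)‖ ≤ 7 * (1 / 2) ^ k)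
    {L : Finset ℕ} {m : ℕ} (hm : 0 < m) (hL : ∀ j ∈ L, m ≤ (F.filter (l · = j)).card) :
    (L.card * m : ℝ) ≤ K := by
  have hδ0 : (0 : ℝ) < (1 / 2) ^ k := by positivity
  have hδ1 : (1 / 2 : ℝ) ^ k < 1 := pow_lt_one₀ (by norm_num) (by norm_num) (by omega)
  have hm' : (1 : ℝ) ≤ m := by exact_mod_cast hm
  have hm0 : (0 : ℝ) < m := by positivity
  have hδm : (1 / 2 : ℝ) ^ k / m ≤ (1 / 2) ^ k := div_le_self hδ0.le hm'
  have hδm0 : 0 < (1 / 2 : ℝ) ^ k / m := by positivity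
  have hL' : ∀ j ∈ L, j < 2 ^ k := fun j hj => by
    obtain ⟨i, hi⟩ := Finset.card_pos.1 (hm.trans_le (hL j hj))
    rw [← (Finset.mem_filter.1 hi).2]
    exact hl i
  have hvol : volume (⋃ j ∈ L, circleCell k j)
      = ENNReal.ofReal (L.card * (2 * Real.pi * (1 / 2) ^ k)) := by
    rw [measure_biUnion_finset (fun i _ j _ hij => disjoint_circleCell k hij)
      fun j _ => measurableSet_circleCell k j]
    simp_rw [volume_circleCell]
    rw [Finset.sum_const, nsmul_eq_mul, ENNReal.ofReal_mul (Nat.cast_nonneg _),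
      ENNReal.ofReal_natCast]
  have h1 := hK (1 - (1 / 2) ^ k / m) (by linarith) (by linarith) (⋃ j ∈ L, circleCell k j)
    (L.measurableSet_biUnion fun j _ => measurableSet_circleCell k j)
    (Set.iUnion₂_subset fun j hj => circleCell_subset (hL' j hj)) fun x hx => by
      obtain ⟨j, hj, hxj⟩ := Set.mem_iUnion₂.1 hx
      refine h.norm_le_of_card_le hm hk (hL j hj)
        (fun i hi => hF i (Finset.mem_filter.1 hi).1) fun i hi => hnear i x ?_
      rwa [(Finset.mem_filter.1 hi).2]
  rw [hvol, ENNReal.toReal_ofReal (by positivity), sub_sub_cancel, mul_div_assoc',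
    le_div_iff₀ hm0] at h1
  have h2 : (L.card * m : ℝ) * (2 * Real.pi) ≤ K := by
    refine le_of_mul_le_mul_right ?_ hδ0
    linarith
  have h3 : (0 : ℝ) ≤ L.card * m := by positivity
  nlinarith [Real.pi_gt_three]

theorem hasExponentialZeros_of_memWeakHardy (h : IsBlaschkeProductOf z B)
    (hB : MemWeakHardy (deriv B) 1) : HasExponentialZeros B := by
  classical
  obtain ⟨-, C, hC, hw⟩ := hB
  simp_rw [Real.rpow_neg_one] at hw
  obtain ⟨K, hK⟩ : ∃ K : ℝ, ∀ r : ℝ, 0 < r → r < 1 → ∀ E : Set ℝ, MeasurableSet E →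
      E ⊆ Set.Ico 0 (2 * Real.pi) →
      (∀ x ∈ E, ‖B (circleMap 0 r x)‖ ≤ 1 - 1 / 326) → (volume E).toReal ≤ K * (1 - r) :=
    ⟨_, fun r hr0 hr1 E hE hE' hEB =>
      h.volume_le_of_norm_le hC hw (by norm_num) (by norm_num) hr0 hr1 hE hE' hEB⟩
  refine h.hasExponentialZeros_iff.2 ⟨⌊K⌋₊ * ⌊K⌋₊, fun k hk F hF => ?_⟩
  choose l hl hnear using fun i => exists_circleCell_near k (z i)
  have hcell : ∀ j ∈ F.image l, (F.filter (l · = j)).card ≤ ⌊K⌋₊ := fun j hj => by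
    obtain ⟨i, hi, rfl⟩ := Finset.mem_image.1 hj
    have hpos : 0 < (F.filter (l · = l i)).card :=
      Finset.card_pos.2 ⟨i, Finset.mem_filter.2 ⟨hi, rfl⟩⟩
    have := h.card_mul_le_of_forall_card_le hK hk hF hl hnear (L := {l i}) hpos
      fun j hj => by rw [Finset.mem_singleton.1 hj]
    rw [Finset.card_singleton, Nat.cast_one, one_mul] at this
    exact Nat.le_floor this
  have hcount : (F.image l).card ≤ ⌊K⌋₊ := by
    have := h.card_mul_le_of_forall_card_le hK hk hF hl hnear (L := F.image l) one_pos
      fun j hj => by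
        obtain ⟨i, hi, rfl⟩ := Finset.mem_image.1 hj
        exact Finset.card_pos.2 ⟨i, Finset.mem_filter.2 ⟨hi, rfl⟩⟩
    rw [Nat.cast_one, mul_one] at this
    exact Nat.le_floor this
  -- At most `⌊K⌋₊` occupied cells with at most `⌊K⌋₊` zeros assigned to each.
  exact (Finset.card_le_mul_card_image F ⌊K⌋₊ hcell).trans (Nat.mul_le_mul_left _ hcount)

end IsBlaschkeProductOf

theorem theorem1 (B : ℂ → ℂ) (hB : IsBlaschkeProduct B) :
    MemWeakHardy (deriv B) 1 ↔ IsExponentialBlaschkeProduct B := by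
  obtain ⟨ι, _, z, h⟩ := isBlaschkeProduct_iff.1 hB
  exact ⟨fun hw => ⟨hB, h.hasExponentialZeros_of_memWeakHardy hw⟩,
    fun he => h.memWeakHardy_deriv he.2⟩
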